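/- Let $H$ be a complex Hilbert space, let $\mathcal N\subseteq B(H)$ be a von Neumann algebra with a faithful normal semifinite trace $\tau$ such that $\tau(1)=\infty$, and suppose that either $\mathcal N$ is diffuse (has no minimal projections) or $\mathcal N=B(H)$. For $A\in\mathcal N$ and $t\ge 0$ put $\mu(t,A)=\inf\{\|Ap\| : p\in\mathcal N \text{ a projection},\ \tau(1-p)\le t\}$, and let $\mathcal M_{1,\infty}$ be the set of all $A\in\mathcal N$ with $$\sup_{t>0}\frac1{\log(1+t)}\int_0^t\mu(s,A)\,ds<\infty .$$ A generalised limit is a positive linear functional $\omega:L_\infty(0,\infty)\to\mathbb R$ with $\omega(1)=1$ and $\omega(z)=0$ for every $z\in L_\infty(0,\infty)$ with $\lim_{t\to\infty}z(t)=0$; it is dilation invariant if $\omega(z(\cdot/s))=\omega(z)$ for all $z\in L_\infty(0,\infty)$ and all $s>0$. Let $$(Mx)(t)=\frac1{\log t}\int_1^t x(s)\,\frac{ds}{s}$$ be the Cesàro operator. For $0<q<\infty$, a positive operator $A\in\mathcal M_{1,\infty}$ and a dilation invariant generalised limit $\omega$ put $$\tau_\omega(A)=\omega\Big(t\mapsto\frac1{\log(1+t)}\int_0^t\mu(s,A)\,ds\Big),\qquad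 \xi_\omega(A)=(\omega\circ M)\Big(t\mapsto\frac1t\,\tau\big(\exp(-(tA)^{-q})\big)\Big),$$ where $\exp(-(tA)^{-q})$ is given by the functional calculus with the function $u\mapsto \exp(-(tu)^{-q})$ on $[0,\infty)$, taken to be $0$ at $u=0$. Theorem. For every $0<q<\infty$ there exist a positive operator $A\in\mathcal M_{1,\infty}$ and a dilation invariant generalised limit $\omega$ on $L_\infty(0,\infty)$ such that $\tau_\omega(A)$ and $\xi_\omega(A)$ are well defined (the traces $\tau(\exp(-(tA)^{-q}))$, $t>0$, are finite, the function $t\mapsto\frac1t\tau(\exp(-(tA)^{-q}))$ is locally integrable on $(0,\infty)$, and the two functions to which $\omega$ is applied belong to $L_\infty(0,\infty)$) and $$\Gamma\Big(1+\frac1q\Big)\,\tau_\omega(A)<\xi_\omega(A).$$ In particular, the identity $\xi_\omega=\Gamma(1+\frac1q)\,\tau_\omega$ does not hold for every dilation invariant generalised limit $\omega$. -/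

import Mathlib

open MeasureTheory Filter Topology
open scoped ENNReal

noncomputable section

namespace NoncommHeat

section LInfinity

/-- Lebesgue measure on the half-line `(0, ∞)`. -/
def halfLine : Measure ℝ := volume.restrict (Set.Ioi 0)

/-- The real Banach lattice `L_∞(0, ∞)`. -/
abbrev LInfty : Type := Lp ℝ ∞ halfLine

theorem memLp_dilate {z : ℝ → ℝ} (hz : MemLp z ∞ halfLine) {s : ℝ} (hs : 0 < s) :
    MemLp (fun t => z (t / s)) ∞ halfLine := by
  have hq : Measure.QuasiMeasurePreserving (fun t : ℝ => t / s) halfLine halfLine := by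
    have hm : Measurable (fun t : ℝ => t / s) := measurable_id.div_const s
    refine ⟨hm, ?_⟩
    refine Measure.AbsolutelyContinuous.mk fun A hA h0 => ?_
    rw [Measure.map_apply hm hA]
    rw [halfLine, Measure.restrict_apply hA] at h0
    rw [halfLine, Measure.restrict_apply (hm hA)]
    have heq : (fun t : ℝ => t / s) ⁻¹' A ∩ Set.Ioi 0
        = (fun t : ℝ => t * s⁻¹) ⁻¹' (A ∩ Set.Ioi 0) := by
      ext t
      simp only [Set.mem_inter_iff, Set.mem_preimage, Set.mem_Ioi, div_eq_mul_inv]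
      have : 0 < t * s⁻¹ ↔ 0 < t := by
        rw [mul_pos_iff_of_pos_right (inv_pos.mpr hs)]
      rw [this]
    rw [heq, Real.volume_preimage_mul_right (inv_ne_zero hs.ne'), h0, mul_zero]
  refine memLp_top_of_bound (hz.1.comp_quasiMeasurePreserving hq)
    (eLpNorm z ∞ halfLine).toReal ?_
  have hb : ∀ᵐ t ∂halfLine, ‖z t‖ ≤ (eLpNorm z ∞ halfLine).toReal := by
    filter_upwards [ae_le_eLpNormEssSup (f := z) (μ := halfLine)] with t ht
    have h2 := hz.2
    rw [eLpNorm_exponent_top] at h2 ⊢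
    simpa using ENNReal.toReal_mono h2.ne ht
  exact hq.ae hb

/-- A generalised limit: a positive normalised linear functional on `L_∞(0, ∞)` that vanishes on
every bounded function tending to zero at infinity. -/
structure IsGeneralisedLimit (ω : LInfty →ₗ[ℝ] ℝ) : Prop where
  nonneg : ∀ z : LInfty, 0 ≤ z → 0 ≤ ω z
  normalised : ω ((memLp_top_const (1 : ℝ)).toLp (fun _ => 1)) = 1
  vanishes : ∀ (z : ℝ → ℝ) (hz : MemLp z ∞ halfLine),
    Tendsto z atTop (𝓝 0) → ω (hz.toLp z) = 0

/-- Invariance under all the dilations `(σ_s z)(t) = z (t / s)`, `s > 0`. -/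
def IsDilationInvariant (ω : LInfty →ₗ[ℝ] ℝ) : Prop :=
  ∀ (z : ℝ → ℝ) (hz : MemLp z ∞ halfLine) (s : ℝ) (hs : 0 < s),
    ω ((memLp_dilate hz hs).toLp (fun t => z (t / s))) = ω (hz.toLp z)

open Classical in
/-- The value `ω(z)` for a function `z` representing an element of `L_∞(0, ∞)`
(and the junk value `0` for other functions). -/
def evalAt (ω : LInfty →ₗ[ℝ] ℝ) (z : ℝ → ℝ) : ℝ :=
  if hz : MemLp z ∞ halfLine then ω (hz.toLp z) else 0

/-- The Cesàro operator `(M x)(t) = (1 / log t) ∫_1^t x(s) ds / s`. -/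
def cesaro (x : ℝ → ℝ) (t : ℝ) : ℝ :=
  (1 / Real.log t) * ∫ s in (1 : ℝ)..t, x s / s

end LInfinity

section Operators

variable {H : Type*} [NormedAddCommGroup H] [InnerProductSpace ℂ H] [CompleteSpace H]

/-- A faithful normal semifinite trace on the von Neumann algebra `N`. Only the values on the
positive cone of `N` are meaningful, and only these are constrained or used. -/
structure FNSTrace (N : VonNeumannAlgebra H) where
  /-- the underlying weight -/
  toFun : (H →L[ℂ] H) → ℝ≥0∞
  map_add : ∀ a ∈ N, ∀ b ∈ N, 0 ≤ a → 0 ≤ b → toFun (a + b) = toFun a + toFun b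
  map_smul : ∀ a ∈ N, 0 ≤ a → ∀ c : ℝ, 0 ≤ c →
    toFun ((c : ℂ) • a) = ENNReal.ofReal c * toFun a
  tracial : ∀ x ∈ N, toFun (star x * x) = toFun (x * star x)
  faithful : ∀ a ∈ N, 0 ≤ a → toFun a = 0 → a = 0
  /-- normality: suprema of bounded upward directed families of positive elements are preserved -/
  normal : ∀ S : Set (H →L[ℂ] H), S.Nonempty → (∀ x ∈ S, x ∈ N ∧ 0 ≤ x) →
    DirectedOn (· ≤ ·) S → ∀ a ∈ N, IsLUB S a → toFun a = ⨆ x ∈ S, toFun x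
  semifinite : ∀ a ∈ N, 0 ≤ a → a ≠ 0 → ∃ b ∈ N, 0 ≤ b ∧ b ≤ a ∧ b ≠ 0 ∧ toFun b ≠ ∞

/-- `N` is diffuse: it has no minimal projection. -/
def IsDiffuse (N : VonNeumannAlgebra H) : Prop :=
  ¬ ∃ p ∈ N, IsStarProjection p ∧ p ≠ 0 ∧
    ∀ r ∈ N, IsStarProjection r → r ≤ p → r = 0 ∨ r = p

variable {N : VonNeumannAlgebra H}

/-- The generalised singular value function
`μ(t, A) = inf {‖A p‖ : p a projection of N with τ(1 - p) ≤ t}`, for `t ≥ 0`. -/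
def singularValue (τ : FNSTrace N) (A : H →L[ℂ] H) (t : ℝ) : ℝ :=
  sInf {r : ℝ | ∃ p ∈ N, IsStarProjection p ∧ τ.toFun (1 - p) ≤ ENNReal.ofReal t ∧ r = ‖A * p‖}

/-- The function `t ↦ (1 / log (1 + t)) ∫_0^t μ(s, A) ds`. -/
def dixmierMean (τ : FNSTrace N) (A : H →L[ℂ] H) (t : ℝ) : ℝ :=
  (1 / Real.log (1 + t)) * ∫ s in (0 : ℝ)..t, singularValue τ A s

/-- The Dixmier ideal `𝓜_{1,∞}(N, τ)`. -/
def dixmierIdeal (τ : FNSTrace N) : Set (H →L[ℂ] H) :=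
  {A | A ∈ N ∧ BddAbove (dixmierMean τ A '' Set.Ioi 0)}

/-- The Dixmier trace `τ_ω(A)` of a positive operator `A` in the Dixmier ideal. -/
def dixmierTrace (τ : FNSTrace N) (ω : LInfty →ₗ[ℝ] ℝ) (A : H →L[ℂ] H) : ℝ :=
  evalAt ω (dixmierMean τ A)

/-- The function `u ↦ exp (-(t u)^(-q))` on `[0, ∞)`, with its limit value `0` at `u = 0`. -/
def heatProfile (q t u : ℝ) : ℝ :=
  if u ≤ 0 then 0 else Real.exp (-(t * u) ^ (-q))

/-- The operator `exp (-(t A)^(-q))`, by continuous functional calculus. -/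
def heatOperator (q : ℝ) (A : H →L[ℂ] H) (t : ℝ) : H →L[ℂ] H :=
  cfc (heatProfile q t) A

/-- The heat kernel function `t ↦ (1 / t) τ(exp (-(t A)^(-q)))`. -/
def heatKernel (τ : FNSTrace N) (q : ℝ) (A : H →L[ℂ] H) (t : ℝ) : ℝ :=
  (1 / t) * (τ.toFun (heatOperator q A t)).toReal

/-- The heat kernel functional `ξ_ω(A) = (ω ∘ M)(t ↦ (1 / t) τ(exp (-(t A)^(-q))))` of a positive
operator `A` in the Dixmier ideal. -/
def heatFunctional (τ : FNSTrace N) (q : ℝ) (ω : LInfty →ₗ[ℝ] ℝ) (A : H →L[ℂ] H) : ℝ :=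
  evalAt ω (cesaro (heatKernel τ q A))

end Operators

end NoncommHeat

end

open NoncommHeat MeasureTheory
open scoped ENNReal

/-! The heat kernel feels a spectral block earlier than the Dixmier mean does, and a limit
concentrated in that delay separates the two functionals. Since the trace is infinite and
semifinite, there are orthogonal projections $p_n$ of finite trace $e^{L_n}$, with $L_n$ growing at
least like iterated squaring (`FNSTrace.exists_rapid_sequence`). Put $a_n=L_ne^{-L_n}$ and $A=\sum
a_np_n$; block $n$ carries mass $a_ne^{L_n}=L_n$. Consider $t$ between $2/a_n$ and $\sqrt{L_n}/a_n$,
where $\log t$ is comparable to $L_n$. In $\int_0^t\mu(s,A)\,ds$, earlier blocks contribute at most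
a multiple of $\sqrt{L_n}$, block $n$ at most $a_nt\le\sqrt{L_n}$, and later blocks a bounded
amount. The Dixmier mean is thus $O(L_n^{-1/2})$ (`dixmierMean_le_of_window`). The heat integral
$\int_1^t\tau(\exp(-(sA)^{-q}))\,ds/s^2$, however, has already passed $s\in[1/a_n,2/a_n]$, where
block $n$ alone gives at least $e^{-1}L_n/4$; its Cesàro mean is at least $e^{-1}/4$
(`le_cesaro_heatKernel_of_window`). The logarithmic lengths $\log(\sqrt{L_n}/2)$ of these windows
tend to infinity, so an ultrafilter limit of $dt/t$-averages over them is dilation invariant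
(`exists_dilationInvariant_generalisedLimit`). For this $\omega$, $\tau_\omega(A)\le0$ and
$\xi_\omega(A)\ge e^{-1}/4$. -/

namespace NoncommHeat

/-! ### Elements and spectral projections of a von Neumann algebra. -/

section VonNeumann

variable {H : Type*} [NormedAddCommGroup H] [InnerProductSpace ℂ H] [CompleteSpace H]

theorem mem_of_forall_commutant {N : VonNeumannAlgebra H} {x : H →L[ℂ] H}
    (h : ∀ y ∈ N.commutant, y * x = x * y) : x ∈ N := by
  rw [← N.commutant_commutant, VonNeumannAlgebra.mem_commutant_iff]
  exact h

theorem isClosed_coe (N : VonNeumannAlgebra H) : IsClosed (N : Set (H →L[ℂ] H)) := by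
  rw [← N.centralizer_centralizer]
  exact Set.isClosed_centralizer _

theorem complex_smul_mem {N : VonNeumannAlgebra H} {x : H →L[ℂ] H} (hx : x ∈ N) (c : ℂ) :
    c • x ∈ N := by
  have : c • x ∈ N.toStarSubalgebra := SMulMemClass.smul_mem c hx
  exact this

theorem real_smul_mem {N : VonNeumannAlgebra H} {x : H →L[ℂ] H} (hx : x ∈ N) (c : ℝ) :
    c • x ∈ N := by
  rw [← Complex.coe_smul]
  exact complex_smul_mem hx c

theorem cfc_mem_vonNeumann {N : VonNeumannAlgebra H} {x : H →L[ℂ] H} (hx : x ∈ N) (f : ℝ → ℝ) :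
    cfc f x ∈ N :=
  mem_of_forall_commutant fun y hy =>
    ((show Commute x y from VonNeumannAlgebra.mem_commutant_iff.mp hy x hx).cfc_real f).eq.symm

/-- The commutant is closed under adjoints, so invariance of `K` under it already forces the
projection to commute with it. -/
theorem starProjection_mem {N : VonNeumannAlgebra H} (K : Submodule ℂ H) [K.HasOrthogonalProjection]
    (h : ∀ y ∈ N.commutant, ∀ x ∈ K, y x ∈ K) : K.starProjection ∈ N := by
  rw [VonNeumannAlgebra.IsStarProjection.mem_iff isStarProjection_starProjection]
  intro y hy
  rw [Submodule.range_starProjection]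
  exact fun x hx => h y hy x hx

/-- A nonzero positive element of a von Neumann algebra dominates a positive multiple of a nonzero
projection of the algebra. -/
theorem exists_smul_projection_le {N : VonNeumannAlgebra H} {b : H →L[ℂ] H} (hb : b ∈ N)
    (hb0 : 0 ≤ b) (hne : b ≠ 0) :
    ∃ ε : ℝ, 0 < ε ∧ ∃ r ∈ N, IsStarProjection r ∧ r ≠ 0 ∧ ε • r ≤ b := by
  have hsa : IsSelfAdjoint b := .of_nonneg hb0
  have hnorm : 0 < ‖b‖ := norm_pos_iff.mpr hne
  set ε : ℝ := ‖b‖ / 2 with hε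
  have hεpos : 0 < ε := by positivity
  have hcm : Continuous fun x : ℝ => min x ε := by fun_prop
  have hcy : Continuous fun x : ℝ => max (x - ε) 0 := by fun_prop
  -- With `m` the truncation of `b` at `ε` and `y` the excess, `m * y = ε • y`. Hence `ker (m - ε)`
  -- contains the range of `y`, and its projection stands in for the spectral projection of `b` on
  -- `[ε, ∞)`, using continuous functions only.
  set m := cfc (fun x : ℝ => min x ε) b with hm
  set y := cfc (fun x : ℝ => max (x - ε) 0) b with hy
  have hmN : m ∈ N := cfc_mem_vonNeumann hb _
  have hspec : ∀ x ∈ spectrum ℝ b, 0 ≤ x := fun x hx => spectrum_nonneg_of_nonneg hb0 hx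
  have hm0 : 0 ≤ m := cfc_nonneg fun x hx => le_min (hspec x hx) hεpos.le
  have hmb : m ≤ b := by
    conv_rhs => rw [← cfc_id' ℝ b]
    exact cfc_mono (fun x _ => min_le_left _ _)
  have hmy : m * y = ε • y := by
    rw [hm, hy, ← cfc_mul .., ← cfc_const_mul ..]
    refine cfc_congr fun x _ => ?_
    rcases le_total x ε with h | h
    · simp [max_eq_right (sub_nonpos.mpr h)]
    · simp [min_eq_right h]
  have hsum : m + y = b := by
    rw [hm, hy, ← cfc_add ..]
    conv_rhs => rw [← cfc_id' ℝ b]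
    refine cfc_congr fun x _ => ?_
    rcases le_total x ε with h | h
    · simp [max_eq_right (sub_nonpos.mpr h), min_eq_left h]
    · simp [min_eq_right h, max_eq_left (sub_nonneg.mpr h)]
  have hyne : y ≠ 0 := by
    intro h0
    have hle : ‖m‖ ≤ ε := by
      refine norm_cfc_le hεpos.le fun x hx => ?_
      rw [Real.norm_of_nonneg (le_min (hspec x hx) hεpos.le)]
      exact min_le_right _ _
    rw [h0, add_zero] at hsum
    rw [hsum] at hle
    linarith
  let K : Submodule ℂ H := (m - ε • (1 : H →L[ℂ] H)).ker
  have hK : ∀ x, x ∈ K ↔ m x = ε • x := by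
    intro x
    simp [K, LinearMap.mem_ker, sub_eq_zero]
  have hKcl : IsClosed (K : Set H) := ContinuousLinearMap.isClosed_ker _
  have : CompleteSpace K := hKcl.completeSpace_coe
  set r := K.starProjection with hr
  have hrp : IsStarProjection r := isStarProjection_starProjection
  have hrN : r ∈ N := by
    refine starProjection_mem K fun z hz x hx => ?_
    rw [hK] at hx ⊢
    have h := VonNeumannAlgebra.mem_commutant_iff.mp hz m hmN
    have h2 : m (z x) = z (m x) := congrArg (fun T : H →L[ℂ] H => T x) h
    rw [h2, hx]
    exact map_real_smul z z.continuous ε x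
  have hmr : m * r = ε • r := by
    ext x
    have : r x ∈ K := Submodule.starProjection_apply_mem K x
    simpa using (hK _).mp this
  have hrm : r * m = ε • r := by
    have := congrArg star hmr
    simpa [hrp.isSelfAdjoint.star_eq, (IsSelfAdjoint.of_nonneg hm0).star_eq] using this
  refine ⟨ε, hεpos, r, hrN, hrp, ?_, ?_⟩
  · intro h0
    apply hyne
    ext x
    have hx : y x ∈ K := by
      rw [hK]
      exact congrArg (fun T : H →L[ℂ] H => T x) hmy
    have : r (y x) = y x := Submodule.starProjection_eq_self_iff.mpr hx
    rw [← this, h0]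
    simp
  · refine le_trans ?_ hmb
    -- Since `r` reduces `m`, this compression equals `m - ε • r`.
    have hconj : 0 ≤ star (1 - r) * m * (1 - r) := star_left_conjugate_nonneg hm0 _
    have : star (1 - r) * m * (1 - r) = m - ε • r := by
      rw [hrp.one_sub.isSelfAdjoint.star_eq, sub_mul, one_mul, hrm, mul_sub, mul_one, sub_mul, hmr,
        smul_mul_assoc, hrp.isIdempotentElem.eq]
      abel
    rw [this] at hconj
    exact sub_nonneg.mp hconj

end VonNeumann

/-! ### The trace: countable additivity and subprojections of large finite trace. -/

section Trace

variable {H : Type*} [NormedAddCommGroup H] [InnerProductSpace ℂ H] [CompleteSpace H]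
variable {N : VonNeumannAlgebra H}

namespace FNSTrace

theorem map_zero (τ : FNSTrace N) : τ.toFun 0 = 0 := by
  simpa using τ.map_smul 0 (zero_mem N) le_rfl 0 le_rfl

theorem map_real_smul (τ : FNSTrace N) {a : H →L[ℂ] H} (ha : a ∈ N) (h0 : 0 ≤ a) {c : ℝ}
    (hc : 0 ≤ c) : τ.toFun (c • a) = ENNReal.ofReal c * τ.toFun a := by
  rw [← τ.map_smul a ha h0 c hc, Complex.coe_smul]

theorem map_sub_add (τ : FNSTrace N) {a b : H →L[ℂ] H} (ha : a ∈ N) (hb : b ∈ N) (h0 : 0 ≤ a)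
    (hab : a ≤ b) : τ.toFun b = τ.toFun a + τ.toFun (b - a) := by
  rw [← τ.map_add a ha _ (sub_mem hb ha) h0 (sub_nonneg.mpr hab), add_sub_cancel]

theorem mono (τ : FNSTrace N) {a b : H →L[ℂ] H} (ha : a ∈ N) (hb : b ∈ N) (h0 : 0 ≤ a)
    (hab : a ≤ b) : τ.toFun a ≤ τ.toFun b := by
  rw [τ.map_sub_add ha hb h0 hab]
  exact le_self_add

theorem map_sum (τ : FNSTrace N) {ι : Type*} (s : Finset ι) (f : ι → H →L[ℂ] H)
    (hf : ∀ i, f i ∈ N) (h0 : ∀ i, 0 ≤ f i) :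
    τ.toFun (∑ i ∈ s, f i) = ∑ i ∈ s, τ.toFun (f i) := by
  classical
  induction s using Finset.induction_on with
  | empty => simp [τ.map_zero]
  | insert i s hi ih =>
    rw [Finset.sum_insert hi, Finset.sum_insert hi, ← ih]
    exact τ.map_add _ (hf i) _ (sum_mem fun j _ => hf j) (h0 i) (Finset.sum_nonneg fun j _ => h0 j)

/-- Normality applied to the directed family of finite partial sums, whose supremum is the sum of
the series. -/
theorem map_tsum (τ : FNSTrace N) (f : ℕ → H →L[ℂ] H) (hf : ∀ i, f i ∈ N) (h0 : ∀ i, 0 ≤ f i)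
    (hs : Summable f) : τ.toFun (∑' i, f i) = ∑' i, τ.toFun (f i) := by
  set S : Set (H →L[ℂ] H) := Set.range fun s : Finset ℕ => ∑ i ∈ s, f i with hS
  have hlub : IsLUB S (∑' i, f i) := isLUB_hasSum h0 hs.hasSum
  have hmem : ∑' i, f i ∈ N :=
    (isClosed_coe N).mem_of_tendsto hs.hasSum
      (Eventually.of_forall fun s => sum_mem fun j _ => hf j)
  have hdir : DirectedOn (· ≤ ·) S := by
    refine directedOn_range.mpr (Monotone.directed_le fun s t hst => ?_)
    exact Finset.sum_le_sum_of_subset_of_nonneg hst fun i _ _ => h0 i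
  rw [τ.normal S (Set.range_nonempty _) ?_ hdir _ hmem hlub, hS, iSup_range, ENNReal.tsum_eq_iSup_sum]
  · exact iSup_congr fun s => τ.map_sum s f hf h0
  · rintro _ ⟨s, rfl⟩
    exact ⟨sum_mem fun j _ => hf j, Finset.sum_nonneg fun j _ => h0 j⟩

/-- A nonzero projection of the algebra has a nonzero subprojection of finite trace. -/
theorem exists_finite_subprojection (τ : FNSTrace N) {e : H →L[ℂ] H} (he : e ∈ N)
    (hp : IsStarProjection e) (hne : e ≠ 0) :
    ∃ r ∈ N, IsStarProjection r ∧ r ≠ 0 ∧ r ≤ e ∧ τ.toFun r ≠ ∞ := by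
  obtain ⟨b, hb, hb0, hbe, hbne, hbfin⟩ := τ.semifinite e he hp.nonneg hne
  obtain ⟨ε, hε, r, hr, hrp, hrne, hrb⟩ := exists_smul_projection_le hb hb0 hbne
  refine ⟨r, hr, hrp, hrne, ?_, ?_⟩
  · rw [hrp.le_iff_mul_eq_left hp]
    have h1 : 0 ≤ ε • r := smul_nonneg hε.le hrp.nonneg
    have h2 := (hp.mul_right_and_mul_left_of_nonneg_of_le h1 (hrb.trans hbe)).1
    rw [smul_mul_assoc] at h2
    exact smul_right_injective _ hε.ne' h2
  · intro htop
    have h1 := τ.mono (real_smul_mem hr ε) hb (smul_nonneg hε.le hrp.nonneg) hrb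
    rw [τ.map_real_smul hr hrp.nonneg hε.le, htop, ENNReal.mul_top (by simpa using hε)] at h1
    exact hbfin (top_le_iff.mp h1)

end FNSTrace

/-- A nonempty chain of projections of the algebra has a least upper bound, which is a projection
of the algebra. -/
theorem exists_isLUB_of_isChain {S : Set (H →L[ℂ] H)} (hne : S.Nonempty)
    (hS : ∀ p ∈ S, p ∈ N ∧ IsStarProjection p) (hc : IsChain (· ≤ ·) S) :
    ∃ P ∈ N, IsStarProjection P ∧ IsLUB S P := by
  have hproj : ∀ p : S, ∃ (_ : (p : H →L[ℂ] H).range.HasOrthogonalProjection),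
      (p : H →L[ℂ] H) = (p : H →L[ℂ] H).range.starProjection := fun p =>
    isStarProjection_iff_eq_starProjection_range.mp (hS p p.2).2
  choose hU hUeq using hproj
  let U : S → Submodule ℂ H := fun p => (p : H →L[ℂ] H).range
  have : ∀ p, (U p).HasOrthogonalProjection := hU
  have hmono : Monotone U := by
    intro p q hpq
    have : (p : H →L[ℂ] H) ≤ q := hpq
    rw [hUeq p, hUeq q] at this
    exact Submodule.starProjection_le_starProjection_iff.mp this
  have : Nonempty S := hne.to_subtype
  have : IsDirectedOrder S := ⟨fun p q => by
    rcases hc.total p.2 q.2 with h | h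
    · exact ⟨q, h, le_rfl⟩
    · exact ⟨p, le_rfl, h⟩⟩
  -- Ordered projections have nested ranges; the supremum projects onto the closure of the union of
  -- the ranges.
  set K := (⨆ p, U p).topologicalClosure with hK
  have : CompleteSpace K := (Submodule.isClosed_topologicalClosure _).completeSpace_coe
  have hle : ∀ p ∈ S, p ≤ K.starProjection := by
    intro p hp
    refine (hUeq ⟨p, hp⟩).trans_le ?_
    exact Submodule.starProjection_le_starProjection_iff.mpr
      ((le_iSup U ⟨p, hp⟩).trans (Submodule.le_topologicalClosure _))
  have htend := Submodule.starProjection_tendsto_closure_iSup U hmono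
  refine ⟨K.starProjection, ?_, isStarProjection_starProjection, hle, ?_⟩
  · refine starProjection_mem K fun y hy x hx => ?_
    have hinv : (⨆ p, U p) ≤ (⨆ p, U p).comap y.toLinearMap := by
      refine iSup_le fun p => ?_
      rintro x ⟨w, rfl⟩
      have h := VonNeumannAlgebra.mem_commutant_iff.mp hy p (hS p p.2).1
      have h2 : (p : H →L[ℂ] H) (y w) = y ((p : H →L[ℂ] H) w) :=
        congrArg (fun T : H →L[ℂ] H => T w) h
      exact (le_iSup U p) ⟨y w, h2⟩
    have hcl : K ≤ K.comap y.toLinearMap := by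
      refine Submodule.topologicalClosure_minimal _ ?_ ?_
      · exact hinv.trans (Submodule.comap_mono (Submodule.le_topologicalClosure _))
      · exact (Submodule.isClosed_topologicalClosure _).preimage y.continuous
    exact hcl hx
  · intro T hT
    rw [ContinuousLinearMap.le_def, ContinuousLinearMap.isPositive_def']
    obtain ⟨p₀, hp₀⟩ := hne
    have hTsa : IsSelfAdjoint T := by
      have h0 : 0 ≤ T := (hS p₀ hp₀).2.nonneg.trans (hT hp₀)
      exact .of_nonneg h0
    -- The projections converge strongly along the chain, so the inequality of quadratic forms
    -- passes to the limit.
    refine ⟨hTsa.sub isStarProjection_starProjection.isSelfAdjoint, fun x => ?_⟩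
    have hlim : Tendsto (fun p : S => (T - (U p).starProjection).reApplyInnerSelf x) atTop
        (𝓝 ((T - K.starProjection).reApplyInnerSelf x)) := by
      simp only [ContinuousLinearMap.reApplyInnerSelf_apply, _root_.sub_apply]
      have := (tendsto_const_nhds (x := T x)).sub (htend x)
      exact (RCLike.continuous_re.tendsto _).comp (this.inner tendsto_const_nhds)
    refine ge_of_tendsto hlim (Eventually.of_forall fun p => ?_)
    have h1 : (p : H →L[ℂ] H) ≤ T := hT p.2
    rw [hUeq p, ContinuousLinearMap.le_def, ContinuousLinearMap.isPositive_def'] at h1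
    exact h1.2 x

namespace FNSTrace

/-- Below a projection of infinite trace there are projections of arbitrarily large finite trace. -/
theorem exists_large_subprojection (τ : FNSTrace N) {e : H →L[ℂ] H} (he : e ∈ N)
    (hp : IsStarProjection e) (htop : τ.toFun e = ∞) (K : ℝ≥0∞) (hK : K ≠ ∞) :
    ∃ r ∈ N, IsStarProjection r ∧ r ≤ e ∧ K ≤ τ.toFun r ∧ τ.toFun r ≠ ∞ := by
  -- Otherwise every finite subprojection of `e` has trace at most `K`. Zorn's lemma, with normality
  -- bounding chains, gives a maximal one `r`. Semifiniteness puts a nonzero finite projection under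
  -- `e - r`, and adding it to `r` contradicts maximality.
  by_contra! hcon
  have hsmall : ∀ r ∈ N, IsStarProjection r → r ≤ e → τ.toFun r ≠ ∞ → τ.toFun r ≤ K := by
    intro r hr hrp hre hfin
    by_contra! hlt
    exact hfin (hcon r hr hrp hre hlt.le)
  let S : Set (H →L[ℂ] H) := {r | r ∈ N ∧ IsStarProjection r ∧ r ≤ e ∧ τ.toFun r ≤ K}
  obtain ⟨r, -, hmax⟩ := zorn_le_nonempty₀ S (fun c hcS hc y hy => by
    obtain ⟨P, hPN, hPp, hlub⟩ := exists_isLUB_of_isChain (N := N) ⟨y, hy⟩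
      (fun p hp => ⟨(hcS hp).1, (hcS hp).2.1⟩) hc
    refine ⟨P, ⟨hPN, hPp, hlub.2 fun p hp => (hcS hp).2.2.1, ?_⟩, fun z hz => hlub.1 hz⟩
    rw [τ.normal c ⟨y, hy⟩ (fun x hx => ⟨(hcS hx).1, (hcS hx).2.1.nonneg⟩) hc.directedOn P hPN hlub]
    exact iSup₂_le fun x hx => (hcS hx).2.2.2) 0
    ⟨zero_mem N, .zero _, hp.nonneg, by simp [τ.map_zero]⟩
  obtain ⟨hrN, hrp, hre, hrK⟩ := hmax.prop
  have hsub : IsStarProjection (e - r) := (hrp.le_iff_sub hp).mp hre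
  have hne : e - r ≠ 0 := by
    intro h0
    rw [sub_eq_zero.mp h0] at htop
    rw [htop] at hrK
    exact hK (top_le_iff.mp hrK)
  obtain ⟨s, hsN, hsp, hsne, hse, hsfin⟩ :=
    τ.exists_finite_subprojection (sub_mem he hrN) hsub hne
  have hrs : r * s = 0 := by
    have h1 : (e - r) * s = s := (hsp.le_iff_mul_eq_right hsub).mp hse
    have h2 : r * e = r := (hrp.le_iff_mul_eq_left hp).mp hre
    rw [← h1, ← mul_assoc, mul_sub, h2, hrp.isIdempotentElem.eq, sub_self, zero_mul]
  have hadd : IsStarProjection (r + s) := hrp.add hsp hrs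
  have hle : r + s ≤ e := by
    have := add_le_add_right hse r
    rwa [add_sub_cancel] at this
  have hτ : τ.toFun (r + s) = τ.toFun r + τ.toFun s := τ.map_add r hrN s hsN hrp.nonneg hsp.nonneg
  have hmem : r + s ∈ S := by
    refine ⟨add_mem hrN hsN, hadd, hle, hsmall _ (add_mem hrN hsN) hadd hle ?_⟩
    rw [hτ]
    exact ENNReal.add_ne_top.mpr ⟨ne_top_of_le_ne_top hK hrK, hsfin⟩
  have h := hmax.eq_of_le hmem (le_add_of_nonneg_right hsp.nonneg)
  exact hsne (by simpa using h.symm)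

end FNSTrace

end Trace

end NoncommHeat

namespace NoncommHeat

/-! ### Orthogonal projections with rapidly growing traces. -/

section Sequence

variable {H : Type*} [NormedAddCommGroup H] [InnerProductSpace ℂ H] [CompleteSpace H]
variable {N : VonNeumannAlgebra H}

/-- A sequence of mutually orthogonal projections of finite trace in `N`. -/
structure IsOrthogonalSequence (τ : FNSTrace N) (p : ℕ → H →L[ℂ] H) : Prop where
  mem : ∀ n, p n ∈ N
  proj : ∀ n, IsStarProjection (p n)
  finite : ∀ n, τ.toFun (p n) ≠ ∞
  orth : ∀ i j, i ≠ j → p i * p j = 0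

/-- A sequence of real numbers growing at least like iterated squaring. -/
def IsRapid (L : ℕ → ℝ) : Prop :=
  ∀ n, (∑ k ∈ Finset.range n, L k) ^ 2 + n + 100 ≤ L n

/-- The complement of a finite projection has infinite trace, so a piece of it of large finite trace
can be added. -/
theorem FNSTrace.exists_larger_projection (τ : FNSTrace N) (hτ : τ.toFun 1 = ∞)
    {P : H →L[ℂ] H} (hP : P ∈ N) (hp : IsStarProjection P) (hfin : τ.toFun P ≠ ∞) (K : ℝ) :
    ∃ Q ∈ N, IsStarProjection Q ∧ P ≤ Q ∧ τ.toFun Q ≠ ∞ ∧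
      K ≤ Real.log (τ.toFun (Q - P)).toReal := by
  have h1N : (1 : H →L[ℂ] H) - P ∈ N := sub_mem (one_mem N) hP
  have htop : τ.toFun (1 - P) = ∞ := by
    have h := τ.map_sub_add hP (one_mem N) hp.nonneg hp.le_one
    rw [hτ] at h
    exact (ENNReal.add_eq_top.mp h.symm).resolve_left hfin
  obtain ⟨r, hrN, hrp, hr1, hrK, hrfin⟩ := τ.exists_large_subprojection h1N hp.one_sub htop
    (ENNReal.ofReal (Real.exp K)) ENNReal.ofReal_ne_top
  have hrP : r * P = 0 := by
    have := (hrp.le_iff_mul_eq_left hp.one_sub).mp hr1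
    rw [← this, mul_assoc, hp.one_sub_mul_self, mul_zero]
  refine ⟨r + P, add_mem hrN hP, hrp.add hp hrP, le_add_of_nonneg_left hrp.nonneg, ?_, ?_⟩
  · rw [τ.map_add r hrN P hP hrp.nonneg hp.nonneg]
    exact ENNReal.add_ne_top.mpr ⟨hrfin, hfin⟩
  · rw [add_sub_cancel_right]
    have h := ENNReal.toReal_mono hrfin hrK
    rw [ENNReal.toReal_ofReal (Real.exp_pos K).le] at h
    simpa using Real.log_le_log (Real.exp_pos K) h

/-- The `p n` are the successive differences of an increasing chain of finite projections starting
at `0`, hence orthogonal. -/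
theorem FNSTrace.exists_rapid_sequence (τ : FNSTrace N) (hτ : τ.toFun 1 = ∞) :
    ∃ p : ℕ → H →L[ℂ] H, IsOrthogonalSequence τ p ∧
      IsRapid fun n => Real.log (τ.toFun (p n)).toReal := by
  let F := {P : H →L[ℂ] H // P ∈ N ∧ IsStarProjection P ∧ τ.toFun P ≠ ∞}
  have step : ∀ P : F, ∃ Q : F, P.1 ≤ Q.1 ∧
      5 * (Real.log (τ.toFun P.1).toReal) ^ 2 + 100 ≤ Real.log (τ.toFun (Q.1 - P.1)).toReal := by
    rintro ⟨P, hP, hp, hfin⟩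
    obtain ⟨Q, hQ, hq, hPQ, hqfin, hK⟩ := τ.exists_larger_projection hτ hP hp hfin
      (5 * (Real.log (τ.toFun P).toReal) ^ 2 + 100)
    exact ⟨⟨Q, hQ, hq, hqfin⟩, hPQ, hK⟩
  choose nxt hnxt using step
  let P : ℕ → F := fun n => Nat.rec ⟨0, zero_mem N, .zero _, by simp [τ.map_zero]⟩ (fun _ => nxt) n
  have hP : ∀ n, P (n + 1) = nxt (P n) := fun n => rfl
  have hmono : Monotone fun n => (P n).1 := monotone_nat_of_le_succ fun n => (hnxt (P n)).1
  let p : ℕ → H →L[ℂ] H := fun n => (P (n + 1)).1 - (P n).1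
  have hpN : ∀ n, p n ∈ N := fun n => sub_mem (P (n + 1)).2.1 (P n).2.1
  have hpp : ∀ n, IsStarProjection (p n) := fun n =>
    ((P n).2.2.1.le_iff_sub (P (n + 1)).2.2.1).mp (hmono n.le_succ)
  have hple : ∀ n, p n ≤ (P (n + 1)).1 := fun n => sub_le_self _ (P n).2.2.1.nonneg
  have hpfin : ∀ n, τ.toFun (p n) ≠ ∞ := fun n =>
    ne_top_of_le_ne_top (P (n + 1)).2.2.2 (τ.mono (hpN n) (P (n + 1)).2.1 (hpp n).nonneg (hple n))
  have horth : ∀ i j, i < j → p i * p j = 0 := by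
    intro i j hij
    have h1 : p i ≤ (P j).1 := (hple i).trans (hmono hij)
    have h2 : p i * (P j).1 = p i := ((hpp i).le_iff_mul_eq_left (P j).2.2.1).mp h1
    have h3 : p i * (P (j + 1)).1 = p i :=
      ((hpp i).le_iff_mul_eq_left (P (j + 1)).2.2.1).mp (h1.trans (hmono j.le_succ))
    rw [show p j = (P (j + 1)).1 - (P j).1 from rfl, mul_sub, h2, h3, sub_self]
  refine ⟨p, ⟨hpN, hpp, hpfin, fun i j hij => ?_⟩, ?_⟩
  · rcases lt_or_gt_of_ne hij with h | h
    · exact horth i j h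
    · have := congrArg star (horth j i h)
      simpa [(hpp i).isSelfAdjoint.star_eq, (hpp j).isSelfAdjoint.star_eq] using this
  · set L : ℕ → ℝ := fun n => Real.log (τ.toFun (p n)).toReal with hL
    have hrec : ∀ n, 5 * (Real.log (τ.toFun (P n).1).toReal) ^ 2 + 100 ≤ L n :=
      fun n => (hnxt (P n)).2
    have hL100 : ∀ n, 100 ≤ L n := fun n => by nlinarith [hrec n]
    have hLP : ∀ n, L n ≤ Real.log (τ.toFun (P (n + 1)).1).toReal := by
      intro n
      have hpos : 0 < (τ.toFun (p n)).toReal := by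
        by_contra! h
        have h0 : (τ.toFun (p n)).toReal = 0 := le_antisymm h ENNReal.toReal_nonneg
        have := hL100 n
        simp only [hL, h0, Real.log_zero] at this
        linarith
      exact Real.log_le_log hpos (ENNReal.toReal_mono (P (n + 1)).2.2.2
        (τ.mono (hpN n) (P (n + 1)).2.1 (hpp n).nonneg (hple n)))
    have hsq : ∀ n, 5 * L n ^ 2 ≤ L (n + 1) := by
      intro n
      have := hrec (n + 1)
      have := hLP n
      have := hL100 n
      nlinarith
    -- With `S` the sum of the earlier terms, `|S| ≤ L n`, so `(S + L n) ^ 2 ≤ 4 * L n ^ 2`. The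
    -- fifth copy of `L n ^ 2` in `hsq` pays for the linear term and the constant.
    intro n
    induction n with
    | zero => simpa using hL100 0
    | succ n ih =>
      rw [Finset.sum_range_succ]
      set S := ∑ k ∈ Finset.range n, L k
      have hn : (0 : ℝ) ≤ n := Nat.cast_nonneg n
      have hSL : |S| ≤ L n := by
        have h100 := hL100 n
        refine abs_le_of_sq_le_sq ?_ (by linarith)
        nlinarith
      have := abs_le.mp hSL
      have h100 := hL100 n
      have := hsq n
      push_cast
      nlinarith

end Sequence

/-! ### Diagonal operators and their functional calculus. -/

section Diagonal

variable {H : Type*} [NormedAddCommGroup H] [InnerProductSpace ℂ H] [CompleteSpace H]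
variable {N : VonNeumannAlgebra H}

/-- The diagonal operator `∑ b_n p_n`. -/
noncomputable def diagonal (p : ℕ → H →L[ℂ] H) (b : ℕ → ℝ) : H →L[ℂ] H := ∑' n, b n • p n

namespace IsOrthogonalSequence

variable {τ : FNSTrace N} {p : ℕ → H →L[ℂ] H} {b : ℕ → ℝ}

theorem summable_norm (hp : IsOrthogonalSequence τ p) (hb : Summable fun n => |b n|) :
    Summable fun n => ‖b n • p n‖ := by
  refine Summable.of_nonneg_of_le (fun n => norm_nonneg _) (fun n => ?_) hb
  rw [norm_smul, Real.norm_eq_abs]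
  exact mul_le_of_le_one_right (abs_nonneg _) ((hp.proj n).norm_le)

theorem summable (hp : IsOrthogonalSequence τ p) (hb : Summable fun n => |b n|) :
    Summable fun n => b n • p n :=
  (hp.summable_norm hb).of_norm

theorem diagonal_mem (hp : IsOrthogonalSequence τ p) (hb : Summable fun n => |b n|) :
    diagonal p b ∈ N :=
  (isClosed_coe N).mem_of_tendsto (hp.summable hb).hasSum
    (Eventually.of_forall fun _ => sum_mem fun j _ => real_smul_mem (hp.mem j) _)

theorem diagonal_nonneg (hp : IsOrthogonalSequence τ p) (hb0 : ∀ n, 0 ≤ b n) :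
    0 ≤ diagonal p b :=
  tsum_nonneg fun n => smul_nonneg (hb0 n) (hp.proj n).nonneg

theorem diagonal_mul (hp : IsOrthogonalSequence τ p) (hb : Summable fun n => |b n|) (n : ℕ) :
    diagonal p b * p n = b n • p n := by
  rw [diagonal, ← (hp.summable hb).tsum_mul_right, tsum_eq_single n]
  · rw [smul_mul_assoc, (hp.proj n).isIdempotentElem.eq]
  · intro m hm
    rw [smul_mul_assoc, hp.orth m n hm, smul_zero]

theorem diagonal_mul_sum (hp : IsOrthogonalSequence τ p) (hb : Summable fun n => |b n|) (m : ℕ) :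
    diagonal p b * ∑ k ∈ Finset.range m, p k = ∑ k ∈ Finset.range m, b k • p k := by
  rw [Finset.mul_sum]
  exact Finset.sum_congr rfl fun k _ => hp.diagonal_mul hb k

theorem tendsto_diagonal_mul (hp : IsOrthogonalSequence τ p) (hb : Summable fun n => |b n|) :
    Tendsto (fun m => diagonal p b * (1 - ∑ k ∈ Finset.range m, p k)) atTop (𝓝 0) := by
  have h := (tendsto_const_nhds (x := diagonal p b)).sub (hp.summable hb).hasSum.tendsto_sum_nat
  simp only [mul_sub, mul_one, hp.diagonal_mul_sum hb]
  simpa [diagonal] using h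

/-- The tail sum is cruder than the supremum of the tail, but costs nothing for rapidly decaying
eigenvalues and is easy to integrate. -/
theorem norm_diagonal_mul_le (hp : IsOrthogonalSequence τ p) (hb : Summable fun n => |b n|)
    (hb0 : ∀ n, 0 ≤ b n) (m : ℕ) :
    ‖diagonal p b * (1 - ∑ k ∈ Finset.range m, p k)‖ ≤ ∑' k, b (k + m) := by
  have h : diagonal p b * (1 - ∑ k ∈ Finset.range m, p k) = ∑' k, b (k + m) • p (k + m) := by
    rw [mul_sub, mul_one, hp.diagonal_mul_sum hb, diagonal,
      ← (hp.summable hb).sum_add_tsum_nat_add m, add_sub_cancel_left]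
  rw [h]
  have hs : Summable fun k => b (k + m) := by
    have := (summable_nat_add_iff m).mpr hb
    simpa only [abs_of_nonneg (hb0 _)] using this
  refine tsum_of_norm_bounded hs.hasSum fun k => ?_
  rw [norm_smul, Real.norm_of_nonneg (hb0 _)]
  exact mul_le_of_le_one_right (hb0 _) ((hp.proj _).norm_le)

theorem sum_proj (hp : IsOrthogonalSequence τ p) (m : ℕ) :
    IsStarProjection (∑ k ∈ Finset.range m, p k) := by
  induction m with
  | zero => simp [IsStarProjection.zero]
  | succ m ih =>
    rw [Finset.sum_range_succ]
    refine ih.add (hp.proj m) ?_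
    rw [Finset.sum_mul]
    exact Finset.sum_eq_zero fun k hk => hp.orth k m (Finset.mem_range.mp hk).ne

theorem trace_diagonal (hp : IsOrthogonalSequence τ p) (hb : Summable fun n => |b n|)
    (hb0 : ∀ n, 0 ≤ b n) :
    τ.toFun (diagonal p b) = ∑' n, ENNReal.ofReal (b n) * τ.toFun (p n) := by
  rw [diagonal, τ.map_tsum _ (fun n => real_smul_mem (hp.mem n) _)
    (fun n => smul_nonneg (hb0 n) (hp.proj n).nonneg) (hp.summable hb)]
  exact tsum_congr fun n => τ.map_real_smul (hp.mem n) (hp.proj n).nonneg (hb0 n)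

end IsOrthogonalSequence

theorem exists_polynomial_near_of_isCompact {K : Set ℝ} (hK : IsCompact K) {f : ℝ → ℝ}
    (hf : Continuous f) {ε : ℝ} (hε : 0 < ε) :
    ∃ P : Polynomial ℝ, ∀ x ∈ K, |P.eval x - f x| < ε := by
  obtain ⟨R, hR⟩ := hK.isBounded.subset_closedBall 0
  obtain ⟨P, hP⟩ := exists_polynomial_near_of_continuousOn (-R) R f hf.continuousOn ε hε
  refine ⟨P, fun x hx => hP x ?_⟩
  have := hR hx
  rw [Real.closedBall_eq_Icc] at this
  simpa using this

/-- If the range of `p` consists of eigenvectors of `A`, then the functional calculus of `A` acts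
on it by the value at the eigenvalue. -/
theorem cfc_mul_of_mul_eq_smul {A p : H →L[ℂ] H} (hA : IsSelfAdjoint A) {a : ℝ}
    (h : A * p = a • p) {f : ℝ → ℝ} (hf : Continuous f) : cfc f A * p = f a • p := by
  have hpoly : ∀ P : Polynomial ℝ, Polynomial.aeval A P * p = P.eval a • p := by
    intro P
    induction P using Polynomial.induction_on' with
    | add P Q hP hQ => simp [add_mul, hP, hQ, add_smul]
    | monomial n c =>
      have hn : A ^ n * p = a ^ n • p := by
        induction n with
        | zero => simp
        | succ n ih => rw [pow_succ, mul_assoc, h, mul_smul_comm, ih, smul_smul, pow_succ, mul_comm]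
      rw [Polynomial.aeval_monomial, mul_assoc, hn, Polynomial.eval_monomial,
        Algebra.algebraMap_eq_smul_one, smul_mul_assoc, one_mul, smul_smul]
  rw [← sub_eq_zero, ← norm_eq_zero]
  refine le_antisymm (le_of_forall_pos_le_add fun ε hε => ?_) (norm_nonneg _)
  rw [zero_add]
  set δ := ε / (2 * (‖p‖ + 1)) with hδ
  have hδpos : 0 < δ := by positivity
  -- The point `a` is adjoined to the spectrum because it need not lie there when `p = 0`.
  obtain ⟨P, hP⟩ := exists_polynomial_near_of_isCompact
    ((ContinuousFunctionalCalculus.isCompact_spectrum (R := ℝ) A).insert a) hf hδpos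
  have h1 : ‖cfc f A - Polynomial.aeval A P‖ ≤ δ := by
    rw [← cfc_polynomial P A, ← cfc_sub ..]
    refine norm_cfc_le hδpos.le fun x hx => ?_
    rw [Real.norm_eq_abs, abs_sub_comm]
    exact (hP x (Set.mem_insert_of_mem _ hx)).le
  have h2 : |P.eval a - f a| ≤ δ := (hP a (Set.mem_insert _ _)).le
  calc ‖cfc f A * p - f a • p‖
      = ‖(cfc f A - Polynomial.aeval A P) * p + (P.eval a - f a) • p‖ := by
        rw [sub_mul, hpoly, sub_smul]; congr 1; abel
    _ ≤ δ * ‖p‖ + δ * ‖p‖ := by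
        refine (norm_add_le _ _).trans (add_le_add ?_ ?_)
        · exact (norm_mul_le _ _).trans (by gcongr)
        · rw [norm_smul]; gcongr; exact h2
    _ = ε * (‖p‖ / (‖p‖ + 1)) := by rw [hδ]; field_simp; ring
    _ ≤ ε := by
        refine mul_le_of_le_one_right hε.le ?_
        rw [div_le_one (by positivity)]
        linarith

/-- The two sides agree on each `p k`, so their difference `X` is unchanged by cutting off finitely
many blocks. The quadratic bound makes `f u / u` continuous at `0`, so `cfc f` factors through the
diagonal operator; the cut-off operators then tend to `0` in norm, and `X = 0`. -/
theorem IsOrthogonalSequence.cfc_diagonal {τ : FNSTrace N} {p : ℕ → H →L[ℂ] H} {b : ℕ → ℝ}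
    (hp : IsOrthogonalSequence τ p) (hb : Summable fun n => |b n|) (hb0 : ∀ n, 0 ≤ b n)
    {f : ℝ → ℝ} (hf : Continuous f) {C : ℝ} (hC : ∀ u, |f u| ≤ C * u ^ 2) :
    (Summable fun n => |f (b n)|) ∧ cfc f (diagonal p b) = diagonal p fun n => f (b n) := by
  have hf0 : f 0 = 0 := by simpa using hC 0
  have hsum : Summable fun n => |f (b n)| := by
    have h2 : Summable fun n => b n ^ 2 := by
      have := hb.of_norm_bounded_eventually_nat (g := fun n => |b n|) (f := fun n => b n ^ 2) (by
        have h0 := hb.tendsto_atTop_zero.eventually (gt_mem_nhds zero_lt_one)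
        filter_upwards [h0] with n hn
        rw [norm_pow, Real.norm_eq_abs, sq]
        exact mul_le_of_le_one_left (abs_nonneg _) hn.le)
      exact this
    exact Summable.of_nonneg_of_le (fun _ => abs_nonneg _) (fun n => hC (b n)) (h2.mul_left C)
  refine ⟨hsum, ?_⟩
  have hsa : IsSelfAdjoint (diagonal p b) := .of_nonneg (hp.diagonal_nonneg hb0)
  have hk : Continuous fun u : ℝ => f u / u := by
    rw [continuous_iff_continuousAt]
    intro u
    rcases eq_or_ne u 0 with rfl | hu
    · rw [ContinuousAt, div_zero]
      refine squeeze_zero_norm (a := fun u => C * |u|) (fun u => ?_) ?_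
      · rcases eq_or_ne u 0 with rfl | hu
        · simp
        · rw [norm_div, Real.norm_eq_abs, Real.norm_eq_abs, div_le_iff₀ (abs_pos.mpr hu), mul_assoc,
            abs_mul_abs_self, ← sq]
          exact hC u
      · have : Continuous fun u : ℝ => C * |u| := by fun_prop
        simpa using this.tendsto 0
    · exact hf.continuousAt.div continuousAt_id hu
  have hfac : cfc f (diagonal p b) = cfc (fun u : ℝ => f u / u) (diagonal p b) * diagonal p b := by
    conv_rhs => arg 2; rw [← cfc_id' ℝ (diagonal p b)]
    rw [← cfc_mul (fun u : ℝ => f u / u) (fun u => u) _ hk.continuousOn continuousOn_id]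
    refine cfc_congr fun u _ => ?_
    rcases eq_or_ne u 0 with rfl | hu
    · simp [hf0]
    · field_simp
  set X := cfc f (diagonal p b) - diagonal p fun n => f (b n) with hX
  have hXp : ∀ m, X * (1 - ∑ k ∈ Finset.range m, p k) = X := by
    intro m
    have : X * ∑ k ∈ Finset.range m, p k = 0 := by
      rw [Finset.mul_sum]
      refine Finset.sum_eq_zero fun k _ => ?_
      rw [hX, sub_mul, cfc_mul_of_mul_eq_smul hsa (hp.diagonal_mul hb k) hf,
        hp.diagonal_mul hsum k, sub_self]
    rw [mul_sub, this, mul_one, sub_zero]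
  have hlim : Tendsto (fun m => X * (1 - ∑ k ∈ Finset.range m, p k)) atTop (𝓝 0) := by
    have h1 := (hp.tendsto_diagonal_mul hb).const_mul (cfc (fun u : ℝ => f u / u) (diagonal p b))
    have h2 := h1.sub (hp.tendsto_diagonal_mul hsum)
    simp only [← mul_assoc, ← hfac, ← sub_mul, mul_zero, sub_zero] at h2
    exact h2
  simp only [hXp] at hlim
  exact sub_eq_zero.mp (tendsto_nhds_unique tendsto_const_nhds hlim)

end Diagonal

end NoncommHeat

namespace NoncommHeat

/-! ### Dilation invariant generalised limits supported on long windows. -/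

section GeneralisedLimit

/-- This makes the logarithmic coordinate, in which dilations are translations, compatible with
almost everywhere equality. -/
theorem quasiMeasurePreserving_exp :
    Measure.QuasiMeasurePreserving Real.exp volume halfLine := by
  refine ⟨Real.measurable_exp, Measure.AbsolutelyContinuous.mk fun A hA h0 => ?_⟩
  rw [halfLine, Measure.restrict_apply hA] at h0
  rw [Measure.map_apply Real.measurable_exp hA]
  have heq : Real.exp ⁻¹' A = Real.log '' (A ∩ Set.Ioi 0) := by
    ext x
    constructor
    · exact fun hx => ⟨Real.exp x, ⟨hx, Real.exp_pos x⟩, Real.log_exp x⟩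
    · rintro ⟨y, ⟨hy, hy0⟩, rfl⟩
      rwa [Set.mem_preimage, Real.exp_log hy0]
  rw [heq]
  refine addHaar_image_eq_zero_of_differentiableOn_of_addHaar_eq_zero volume
    (fun y hy => ?_) h0
  exact (Real.differentiableAt_log (ne_of_gt hy.2)).differentiableWithinAt

/-- The average of `z` over `[exp α, exp β]` for the measure `dt / t`. -/
noncomputable def logAverage (α β : ℝ) (z : ℝ → ℝ) : ℝ := (β - α)⁻¹ * ∫ x in α..β, z (Real.exp x)

theorem MemLp.ae_abs_comp_exp_le {z : ℝ → ℝ} (hz : MemLp z ∞ halfLine) :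
    ∀ᵐ x : ℝ, ‖z (Real.exp x)‖ ≤ (eLpNorm z ∞ halfLine).toReal := by
  have hb : ∀ᵐ t ∂halfLine, ‖z t‖ ≤ (eLpNorm z ∞ halfLine).toReal := by
    filter_upwards [ae_le_eLpNormEssSup (f := z) (μ := halfLine)] with t ht
    have h2 := hz.2
    rw [eLpNorm_exponent_top] at h2 ⊢
    simpa using ENNReal.toReal_mono h2.ne ht
  exact quasiMeasurePreserving_exp.ae hb

theorem MemLp.intervalIntegrable_comp_exp {z : ℝ → ℝ} (hz : MemLp z ∞ halfLine) (α β : ℝ) :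
    IntervalIntegrable (fun x => z (Real.exp x)) volume α β := by
  rw [intervalIntegrable_iff]
  refine Measure.integrableOn_of_bounded (M := (eLpNorm z ∞ halfLine).toReal) ?_ ?_ ?_
  · simp
  · exact hz.1.comp_quasiMeasurePreserving quasiMeasurePreserving_exp
  · exact ae_restrict_of_ae (MemLp.ae_abs_comp_exp_le hz)

theorem MemLp.norm_integral_comp_exp_le {z : ℝ → ℝ} (hz : MemLp z ∞ halfLine) (α β : ℝ) :
    ‖∫ x in α..β, z (Real.exp x)‖ ≤ (eLpNorm z ∞ halfLine).toReal * |β - α| :=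
  intervalIntegral.norm_integral_le_of_norm_le_const_ae <| by
    filter_upwards [MemLp.ae_abs_comp_exp_le hz] with x hx _ using hx

theorem logAverage_congr {z w : ℝ → ℝ} (h : z =ᵐ[halfLine] w) (α β : ℝ) :
    logAverage α β z = logAverage α β w := by
  rw [logAverage, logAverage]
  congr 1
  refine intervalIntegral.integral_congr_ae ?_
  filter_upwards [quasiMeasurePreserving_exp.ae h] with x hx _ using hx

theorem MemLp.abs_logAverage_le {z : ℝ → ℝ} (hz : MemLp z ∞ halfLine) {α β : ℝ} (h : α < β) :
    |logAverage α β z| ≤ (eLpNorm z ∞ halfLine).toReal := by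
  have hpos : 0 < β - α := sub_pos.mpr h
  have h1 := MemLp.norm_integral_comp_exp_le hz α β
  rw [abs_of_pos hpos, Real.norm_eq_abs] at h1
  rw [logAverage, abs_mul, abs_of_pos (inv_pos.mpr hpos), inv_mul_le_iff₀ hpos, mul_comm]
  exact h1

theorem MemLp.logAverage_add {z w : ℝ → ℝ} (hz : MemLp z ∞ halfLine) (hw : MemLp w ∞ halfLine)
    (α β : ℝ) : logAverage α β (z + w) = logAverage α β z + logAverage α β w := by
  rw [logAverage, logAverage, logAverage, ← mul_add, ← intervalIntegral.integral_add
    (MemLp.intervalIntegrable_comp_exp hz α β) (MemLp.intervalIntegrable_comp_exp hw α β)]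
  rfl

theorem logAverage_smul (c : ℝ) (z : ℝ → ℝ) (α β : ℝ) :
    logAverage α β (c • z) = c * logAverage α β z := by
  simp only [logAverage, Pi.smul_apply, smul_eq_mul, intervalIntegral.integral_const_mul]
  ring

theorem MemLp.le_logAverage {z : ℝ → ℝ} (hz : MemLp z ∞ halfLine) {α β c : ℝ} (h : α < β)
    (hc : ∀ᵐ x, x ∈ Set.Icc α β → c ≤ z (Real.exp x)) : c ≤ logAverage α β z := by
  have hpos : 0 < β - α := sub_pos.mpr h
  rw [logAverage, le_inv_mul_iff₀ hpos]
  have h1 : ∫ _ in α..β, c = (β - α) * c := by simp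
  rw [← h1]
  refine intervalIntegral.integral_mono_ae_restrict h.le (by simp)
    (MemLp.intervalIntegrable_comp_exp hz α β) ?_
  rw [EventuallyLE, ae_restrict_iff' measurableSet_Icc]
  exact hc

/-- Dilation translates the window by `log s`, so only two end intervals of length `|log s|` fail to
cancel. -/
theorem MemLp.abs_logAverage_dilate_sub_le {z : ℝ → ℝ} (hz : MemLp z ∞ halfLine) {s : ℝ}
    (hs : 0 < s) {α β : ℝ} (h : α < β) :
    |logAverage α β (fun t => z (t / s)) - logAverage α β z| ≤
      (β - α)⁻¹ * (2 * (eLpNorm z ∞ halfLine).toReal * |Real.log s|) := by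
  have hpos : 0 < β - α := sub_pos.mpr h
  have hI := MemLp.intervalIntegrable_comp_exp hz
  have hshift : ∫ x in α..β, z (Real.exp x / s)
      = ∫ x in (α - Real.log s)..(β - Real.log s), z (Real.exp x) := by
    rw [← intervalIntegral.integral_comp_sub_right (fun x => z (Real.exp x)) (Real.log s)]
    simp only [Real.exp_sub, Real.exp_log hs]
  have hdiff : (∫ x in (α - Real.log s)..(β - Real.log s), z (Real.exp x))
      - ∫ x in α..β, z (Real.exp x)
      = (∫ x in (α - Real.log s)..α, z (Real.exp x))
        - ∫ x in (β - Real.log s)..β, z (Real.exp x) := by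
    have h1 := intervalIntegral.integral_add_adjacent_intervals
      (hI (α - Real.log s) (β - Real.log s)) (hI (β - Real.log s) β)
    have h2 := intervalIntegral.integral_add_adjacent_intervals
      (hI (α - Real.log s) α) (hI α β)
    linarith
  rw [logAverage, logAverage, ← mul_sub, hshift, hdiff, abs_mul, abs_of_pos (inv_pos.mpr hpos)]
  have h1 := MemLp.norm_integral_comp_exp_le hz (α - Real.log s) α
  have h2 := MemLp.norm_integral_comp_exp_le hz (β - Real.log s) β
  rw [sub_sub_cancel, Real.norm_eq_abs] at h1 h2
  gcongr
  refine (abs_sub _ _).trans ?_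
  linarith

/-- Along windows `[exp α_n, exp β_n]` whose logarithmic length tends to infinity there is a
dilation invariant generalised limit bounded below by asymptotic lower bounds on the windows. -/
theorem exists_dilationInvariant_generalisedLimit {α β : ℕ → ℝ} (hα : Tendsto α atTop atTop)
    (hαβ : Tendsto (fun n => β n - α n) atTop atTop) :
    ∃ ω : LInfty →ₗ[ℝ] ℝ, IsGeneralisedLimit ω ∧ IsDilationInvariant ω ∧
      ∀ (z : ℝ → ℝ) (hz : MemLp z ∞ halfLine) (c : ℝ),
        (∀ᶠ n in atTop, ∀ x ∈ Set.Icc (α n) (β n), c ≤ z (Real.exp x)) → c ≤ ω (hz.toLp z) := by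
  -- Window averages of a bounded function are bounded, so they converge along an ultrafilter;
  -- linearity then passes to the limit.
  let U : Ultrafilter ℕ := hyperfilter ℕ
  have hU : (U : Filter ℕ) ≤ atTop := Nat.hyperfilter_le_atTop
  have hlt : ∀ᶠ n in (U : Filter ℕ), α n < β n :=
    hU <| (hαβ.eventually_gt_atTop 0).mono fun n hn => sub_pos.mp hn
  have hex : ∀ z : LInfty, ∃ l, Tendsto (fun n => logAverage (α n) (β n) z) U (𝓝 l) := by
    intro z
    have hmem : ∀ᶠ n in (U : Filter ℕ), logAverage (α n) (β n) z ∈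
        Set.Icc (-(eLpNorm z ∞ halfLine).toReal) (eLpNorm z ∞ halfLine).toReal :=
      hlt.mono fun n hn => abs_le.mp (MemLp.abs_logAverage_le (Lp.memLp z) hn)
    obtain ⟨l, -, hl⟩ := isCompact_Icc.ultrafilter_le_nhds
      (U.map fun n => logAverage (α n) (β n) z) (le_principal_iff.mpr hmem)
    exact ⟨l, hl⟩
  choose lim hlim using hex
  let ω : LInfty →ₗ[ℝ] ℝ :=
    { toFun := lim
      map_add' := fun z w => by
        refine tendsto_nhds_unique (hlim (z + w)) (((hlim z).add (hlim w)).congr fun n => ?_)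
        rw [← MemLp.logAverage_add (Lp.memLp z) (Lp.memLp w)]
        exact logAverage_congr (Lp.coeFn_add z w).symm _ _
      map_smul' := fun c z => by
        refine tendsto_nhds_unique (hlim (c • z)) (((hlim z).const_mul c).congr fun n => ?_)
        rw [← logAverage_smul]
        exact logAverage_congr (Lp.coeFn_smul c z).symm _ _ }
  have htend : ∀ (z : ℝ → ℝ) (hz : MemLp z ∞ halfLine),
      Tendsto (fun n => logAverage (α n) (β n) z) U (𝓝 (ω (hz.toLp z))) := fun z hz =>
    (hlim (hz.toLp z)).congr fun n => logAverage_congr hz.coeFn_toLp _ _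
  have hlower : ∀ (z : ℝ → ℝ) (hz : MemLp z ∞ halfLine) (c : ℝ),
      (∀ᶠ n in atTop, ∀ x ∈ Set.Icc (α n) (β n), c ≤ z (Real.exp x)) → c ≤ ω (hz.toLp z) := by
    intro z hz c hc
    refine ge_of_tendsto (htend z hz) ?_
    filter_upwards [hlt, hU hc] with n hn hcn
    exact MemLp.le_logAverage hz hn (Eventually.of_forall hcn)
  refine ⟨ω, ⟨fun z hz => ?_, ?_, fun z hz h0 => ?_⟩, fun z hz s hs => ?_, hlower⟩
  · refine ge_of_tendsto (hlim z) ?_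
    filter_upwards [hlt] with n hn
    refine MemLp.le_logAverage (Lp.memLp z) hn ?_
    have h := quasiMeasurePreserving_exp.ae ((Lp.coeFn_nonneg z).mpr hz)
    filter_upwards [h] with x hx _ using hx
  · refine tendsto_nhds_unique (htend _ _) (tendsto_const_nhds.congr' ?_)
    filter_upwards [hlt] with n hn
    simp [logAverage, inv_mul_cancel₀ (sub_pos.mpr hn).ne']
  · have hexp : Tendsto (fun n => Real.exp (α n)) atTop atTop := Real.tendsto_exp_atTop.comp hα
    have key : ∀ (w : ℝ → ℝ) (hw : MemLp w ∞ halfLine), Tendsto w atTop (𝓝 0) →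
        0 ≤ ω (hw.toLp w) := by
      intro w hw hw0
      refine le_of_forall_pos_le_add fun ε hε => ?_
      have h1 : -ε ≤ ω (hw.toLp w) := by
        refine hlower w hw _ ?_
        obtain ⟨R, hR⟩ := eventually_atTop.mp (hw0.eventually (lt_mem_nhds (neg_neg_iff_pos.mpr hε)))
        filter_upwards [hexp.eventually_ge_atTop R] with n hn x hx
        exact (hR _ (hn.trans (Real.exp_le_exp.mpr hx.1))).le
      linarith
    have h1 := key z hz h0
    have h2 := key (-z) hz.neg (neg_zero (G := ℝ) ▸ h0.neg)
    have h3 : hz.neg.toLp (-z) = -hz.toLp z := MemLp.toLp_neg hz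
    rw [h3, map_neg] at h2
    linarith
  · rw [← sub_eq_zero]
    have h1 := (htend _ (memLp_dilate hz hs)).sub (htend z hz)
    refine tendsto_nhds_unique h1 (squeeze_zero_norm' ?_ ((?_ : Tendsto (fun n => (β n - α n)⁻¹ *
      (2 * (eLpNorm z ∞ halfLine).toReal * |Real.log s|)) atTop (𝓝 0)).mono_left hU))
    · filter_upwards [hlt] with n hn
      exact MemLp.abs_logAverage_dilate_sub_le hz hs hn
    · simpa using hαβ.inv_tendsto_atTop.mul_const _

end GeneralisedLimit

end NoncommHeat

namespace NoncommHeat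

/-! ### Numerical estimates for the eigenvalues. -/

section Rapid

/-- The eigenvalue `log d / d` attached to a projection of trace `d = exp (L n)`. -/
noncomputable def rapidEigenvalue (L : ℕ → ℝ) (n : ℕ) : ℝ := L n * Real.exp (-L n)

namespace IsRapid

variable {L : ℕ → ℝ}

theorem hundred_le (hL : IsRapid L) (n : ℕ) : 100 ≤ L n := by
  have := hL n
  have hn : (0 : ℝ) ≤ n := Nat.cast_nonneg n
  nlinarith [sq_nonneg (∑ k ∈ Finset.range n, L k)]

theorem pos (hL : IsRapid L) (n : ℕ) : 0 < L n := by linarith [hL.hundred_le n]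

theorem natCast_le (hL : IsRapid L) (n : ℕ) : (n : ℝ) ≤ L n := by
  nlinarith [hL n, sq_nonneg (∑ k ∈ Finset.range n, L k)]

theorem tendsto (hL : IsRapid L) : Tendsto L atTop atTop :=
  tendsto_atTop_mono hL.natCast_le tendsto_natCast_atTop_atTop

theorem sum_nonneg (hL : IsRapid L) (n : ℕ) : 0 ≤ ∑ k ∈ Finset.range n, L k :=
  Finset.sum_nonneg fun k _ => (hL.pos k).le

/-- The total mass of the blocks before `n` is thus negligible against `L n`. -/
theorem sum_le_sqrt (hL : IsRapid L) (n : ℕ) : ∑ k ∈ Finset.range n, L k ≤ √(L n) := by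
  refine Real.le_sqrt_of_sq_le ?_
  have hn : (0 : ℝ) ≤ n := Nat.cast_nonneg n
  linarith [hL n]

theorem sqrt_le (hL : IsRapid L) (n : ℕ) : √(L n) ≤ L n := by
  rw [Real.sqrt_le_left (hL.pos n).le]
  nlinarith [hL.hundred_le n]

theorem two_mul_le_of_lt (hL : IsRapid L) {n k : ℕ} (h : n < k) : 2 * L n ≤ L k := by
  have h1 : L n ≤ ∑ j ∈ Finset.range k, L j :=
    Finset.single_le_sum (fun j _ => (hL.pos j).le) (Finset.mem_range.mpr h)
  have h2 := hL k
  have hk : (0 : ℝ) ≤ k := Nat.cast_nonneg k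
  nlinarith [hL.hundred_le n]

theorem eigenvalue_pos (hL : IsRapid L) (n : ℕ) : 0 < rapidEigenvalue L n :=
  mul_pos (hL.pos n) (Real.exp_pos _)

theorem eigenvalue_mul_exp (n : ℕ) : rapidEigenvalue L n * Real.exp (L n) = L n := by
  rw [rapidEigenvalue, mul_assoc, ← Real.exp_add]
  simp

theorem summable_sq_mul_exp (hL : IsRapid L) :
    Summable fun n => L n ^ 2 * Real.exp (-(L n / 2)) := by
  have hg : Summable fun n : ℕ => 128 * Real.exp (-(1 / 4 : ℝ)) ^ n :=
    (summable_geometric_of_lt_one (Real.exp_pos _).le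
      (Real.exp_lt_one_iff.mpr (by norm_num))).mul_left _
  refine Summable.of_nonneg_of_le (fun n => by positivity) (fun n => ?_) hg
  have hp := hL.pos n
  -- From `y ^ 2 / 2 ≤ exp y` at `y = L n / 8`; half of the decay `exp (-(L n / 2))` is left for the
  -- geometric series.
  have h1 : L n ^ 2 ≤ 128 * Real.exp (L n / 4) := by
    have h := Real.pow_div_factorial_le_exp (x := L n / 8) (by positivity) 2
    have h2 : Real.exp (L n / 8) ≤ Real.exp (L n / 4) := Real.exp_le_exp.mpr (by linarith)
    have h3 : (L n / 8) ^ 2 / (Nat.factorial 2 : ℕ) = L n ^ 2 / 128 := by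
      norm_num [Nat.factorial]; ring
    rw [h3] at h
    linarith
  calc L n ^ 2 * Real.exp (-(L n / 2))
      ≤ 128 * Real.exp (L n / 4) * Real.exp (-(L n / 2)) := by gcongr
    _ = 128 * Real.exp (-(L n / 4)) := by
        rw [mul_assoc, ← Real.exp_add]; ring_nf
    _ ≤ 128 * Real.exp (-(1 / 4 : ℝ)) ^ n := by
        rw [← Real.exp_nat_mul]
        gcongr
        linarith [hL.natCast_le n]

theorem mul_eigenvalue_le (hL : IsRapid L) (n : ℕ) :
    L n * rapidEigenvalue L n ≤ L n ^ 2 * Real.exp (-(L n / 2)) := by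
  have hp := hL.pos n
  rw [rapidEigenvalue, ← mul_assoc, ← sq]
  gcongr
  linarith

theorem summable_mul_eigenvalue (hL : IsRapid L) : Summable fun n => L n * rapidEigenvalue L n :=
  Summable.of_nonneg_of_le (fun n => (mul_pos (hL.pos n) (hL.eigenvalue_pos n)).le)
    hL.mul_eigenvalue_le hL.summable_sq_mul_exp

theorem summable_eigenvalue (hL : IsRapid L) : Summable (rapidEigenvalue L) := by
  refine Summable.of_nonneg_of_le (fun n => (hL.eigenvalue_pos n).le) (fun n => ?_)
    hL.summable_mul_eigenvalue
  exact le_mul_of_one_le_left (hL.eigenvalue_pos n).le (by linarith [hL.hundred_le n])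

/-- The last term not exceeding `x` dominates the sum of all terms before it. -/
theorem sum_ite_le (hL : IsRapid L) {x : ℝ} (hx : 0 ≤ x) (m : ℕ) :
    ∑ k ∈ Finset.range m, (if L k ≤ x then L k else 0) ≤ 2 * x := by
  induction m with
  | zero => simpa using hx
  | succ m ih =>
    rw [Finset.sum_range_succ]
    split_ifs with h
    · have h1 : ∑ k ∈ Finset.range m, (if L k ≤ x then L k else 0) ≤ ∑ k ∈ Finset.range m, L k :=
        Finset.sum_le_sum fun k _ => by split_ifs <;> linarith [hL.pos k]
      linarith [hL.sum_le_sqrt m, hL.sqrt_le m]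
    · linarith

theorem summable_mul_min (hL : IsRapid L) {T : ℝ} (hT : 0 ≤ T) :
    Summable fun k => L k * min 1 (rapidEigenvalue L k * T) := by
  refine Summable.of_nonneg_of_le (fun k => ?_) (fun k => ?_) (hL.summable_mul_eigenvalue.mul_right T)
  · exact mul_nonneg (hL.pos k).le (le_min zero_le_one (mul_nonneg (hL.eigenvalue_pos k).le hT))
  · rw [mul_assoc]
    exact mul_le_mul_of_nonneg_left (min_le_right _ _) (hL.pos k).le

/-- This sum controls both the singular value integral and the heat integral. Blocks with `L k ≤ 2 *
log (1 + T)` are bounded by their full mass `L k`; for the others the eigenvalue is so small that `L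
k * (rapidEigenvalue L k * T)` is summable. -/
theorem tsum_mul_min_le (hL : IsRapid L) {T : ℝ} (hT : 0 < T) :
    ∑' k, L k * min 1 (rapidEigenvalue L k * T) ≤
      (4 + ∑' k, L k ^ 2 * Real.exp (-(L k / 2))) * Real.log (1 + T) := by
  set lam := Real.log (1 + T) with hlam
  have hlam0 : 0 < lam := Real.log_pos (by linarith)
  have hexp : Real.exp lam = 1 + T := Real.exp_log (by linarith)
  -- The factor `lam` keeps the estimate proportional to `log (1 + T)` even as `T` tends to `0`.
  have hTle : T ≤ Real.exp lam * lam := by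
    have h := Real.one_sub_inv_le_log_of_pos (show 0 < 1 + T by linarith)
    rw [hexp]
    have h2 : (1 + T) * (1 - (1 + T)⁻¹) = T := by field_simp; ring
    calc T = (1 + T) * (1 - (1 + T)⁻¹) := h2.symm
      _ ≤ (1 + T) * lam := by gcongr
  have hterm : ∀ k, L k * min 1 (rapidEigenvalue L k * T) ≤
      (if L k ≤ 2 * lam then L k else 0) + L k ^ 2 * Real.exp (-(L k / 2)) * lam := by
    intro k
    have hp := hL.pos k
    split_ifs with h
    · have h1 : L k * min 1 (rapidEigenvalue L k * T) ≤ L k :=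
        mul_le_of_le_one_right hp.le (min_le_left _ _)
      have h2 : 0 ≤ L k ^ 2 * Real.exp (-(L k / 2)) * lam := by positivity
      linarith
    · rw [zero_add]
      push Not at h
      calc L k * min 1 (rapidEigenvalue L k * T)
          ≤ L k * (rapidEigenvalue L k * T) := by gcongr; exact min_le_right _ _
        _ ≤ L k * (rapidEigenvalue L k * (Real.exp (L k / 2) * lam)) := by
            have := (hL.eigenvalue_pos k).le
            have h3 : Real.exp lam ≤ Real.exp (L k / 2) := Real.exp_le_exp.mpr (by linarith)
            have h4 : T ≤ Real.exp (L k / 2) * lam := hTle.trans (by gcongr)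
            gcongr
        _ = L k ^ 2 * (Real.exp (-L k) * Real.exp (L k / 2)) * lam := by
            rw [rapidEigenvalue]; ring
        _ = L k ^ 2 * Real.exp (-(L k / 2)) * lam := by
            rw [← Real.exp_add]; ring_nf
  refine Real.tsum_le_of_sum_range_le (fun k => ?_) fun m => ?_
  · exact mul_nonneg (hL.pos k).le (le_min zero_le_one (mul_pos (hL.eigenvalue_pos k) hT).le)
  · refine (Finset.sum_le_sum fun k _ => hterm k).trans ?_
    rw [Finset.sum_add_distrib, ← Finset.sum_mul, add_mul]
    refine add_le_add ?_ ?_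
    · linarith [hL.sum_ite_le (show 0 ≤ 2 * lam by linarith) m]
    · gcongr
      exact hL.summable_sq_mul_exp.sum_le_tsum _ fun k _ => by positivity

theorem eigenvalue_mul_min_le (hL : IsRapid L) {T : ℝ} (hT : 0 ≤ T) (k : ℕ) :
    rapidEigenvalue L k * min T (2 * Real.exp (L k)) ≤
      2 * (L k * min 1 (rapidEigenvalue L k * T)) := by
  have ha := hL.eigenvalue_pos k
  have hp := hL.hundred_le k
  have h1 := eigenvalue_mul_exp (L := L) k
  rcases le_total 1 (rapidEigenvalue L k * T) with h | h
  · rw [min_eq_left h]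
    calc _ ≤ rapidEigenvalue L k * (2 * Real.exp (L k)) := by gcongr; exact min_le_right _ _
      _ = _ := by linarith
  · rw [min_eq_right h]
    calc _ ≤ rapidEigenvalue L k * T := by gcongr; exact min_le_left _ _
      _ ≤ _ := by nlinarith [mul_nonneg ha.le hT]

theorem summable_eigenvalue_mul_min (hL : IsRapid L) {T : ℝ} (hT : 0 ≤ T) :
    Summable fun k => rapidEigenvalue L k * min T (2 * Real.exp (L k)) :=
  Summable.of_nonneg_of_le
    (fun k => mul_nonneg (hL.eigenvalue_pos k).le (le_min hT (by positivity)))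
    (fun k => hL.eigenvalue_mul_min_le hT k) ((hL.summable_mul_min hT).mul_left 2)

theorem tsum_eigenvalue_mul_min_le (hL : IsRapid L) {T : ℝ} (hT : 0 < T) :
    ∑' k, rapidEigenvalue L k * min T (2 * Real.exp (L k)) ≤
      2 * (4 + ∑' k, L k ^ 2 * Real.exp (-(L k / 2))) * Real.log (1 + T) := by
  calc _ ≤ ∑' k, 2 * (L k * min 1 (rapidEigenvalue L k * T)) :=
        (hL.summable_eigenvalue_mul_min hT.le).tsum_le_tsum
          (fun k => hL.eigenvalue_mul_min_le hT.le k)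
          ((hL.summable_mul_min hT.le).mul_left 2)
    _ ≤ _ := by
        rw [tsum_mul_left, mul_assoc]
        exact mul_le_mul_of_nonneg_left (hL.tsum_mul_min_le hT) zero_le_two

/-- Blocks before `n` give at most twice their mass, block `n` only `rapidEigenvalue L n * T`, and
for `k > n` the bound `T ≤ exp (L n) ≤ exp (L k / 2)` gives a convergent tail. -/
theorem tsum_eigenvalue_mul_min_le_of_window (hL : IsRapid L) (n : ℕ) {T : ℝ} (hT : 0 ≤ T)
    (hTn : rapidEigenvalue L n * T ≤ √(L n)) :
    ∑' k, rapidEigenvalue L k * min T (2 * Real.exp (L k)) ≤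
      3 * √(L n) + ∑' k, L k ^ 2 * Real.exp (-(L k / 2)) := by
  have hsum := hL.summable_eigenvalue_mul_min hT
  have hTexp : T ≤ Real.exp (L n) := by
    have h1 := hTn.trans (hL.sqrt_le n)
    rw [← eigenvalue_mul_exp (L := L) n] at h1
    exact le_of_mul_le_mul_left h1 (hL.eigenvalue_pos n)
  rw [← hsum.sum_add_tsum_nat_add (n + 1), Finset.sum_range_succ]
  have h1 : ∑ k ∈ Finset.range n, rapidEigenvalue L k * min T (2 * Real.exp (L k)) ≤
      2 * √(L n) := by
    calc _ ≤ ∑ k ∈ Finset.range n, 2 * L k := by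
          refine Finset.sum_le_sum fun k _ => ?_
          have := (hL.eigenvalue_pos k).le
          calc _ ≤ rapidEigenvalue L k * (2 * Real.exp (L k)) := by gcongr; exact min_le_right _ _
            _ = 2 * L k := by linarith [eigenvalue_mul_exp (L := L) k]
      _ ≤ _ := by
          rw [← Finset.mul_sum]
          linarith [hL.sum_le_sqrt n]
  have h2 : rapidEigenvalue L n * min T (2 * Real.exp (L n)) ≤ √(L n) := by
    refine le_trans ?_ hTn
    have := (hL.eigenvalue_pos n).le
    gcongr
    exact min_le_left _ _
  have hw := hL.summable_sq_mul_exp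
  have hwn := (summable_nat_add_iff (n + 1)).mpr hw
  have h3 : ∑' k, rapidEigenvalue L (k + (n + 1)) * min T (2 * Real.exp (L (k + (n + 1)))) ≤
      ∑' k, L k ^ 2 * Real.exp (-(L k / 2)) := by
    refine le_trans (((summable_nat_add_iff (n + 1)).mpr hsum).tsum_le_tsum (fun k => ?_) hwn) ?_
    · set j := k + (n + 1) with hj
      have hj2 : 2 * L n ≤ L j := hL.two_mul_le_of_lt (by omega)
      have := hL.hundred_le j
      calc rapidEigenvalue L j * min T (2 * Real.exp (L j))
          ≤ rapidEigenvalue L j * Real.exp (L j / 2) := by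
            have := (hL.eigenvalue_pos j).le
            gcongr
            exact (min_le_left _ _).trans (hTexp.trans (Real.exp_le_exp.mpr (by linarith)))
        _ = L j * Real.exp (-(L j / 2)) := by
            rw [rapidEigenvalue, mul_assoc, ← Real.exp_add]; ring_nf
        _ ≤ L j ^ 2 * Real.exp (-(L j / 2)) := by
            gcongr
            nlinarith
    · rw [← hw.sum_add_tsum_nat_add (n + 1)]
      exact le_add_of_nonneg_left (Finset.sum_nonneg fun k _ => by positivity)
  linarith

theorem log_inv_eigenvalue_ge (hL : IsRapid L) (n : ℕ) :
    L n / 2 ≤ Real.log (rapidEigenvalue L n)⁻¹ := by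
  have hp := hL.pos n
  have h1 : Real.log (L n) ≤ L n / 2 := by
    have h := Real.log_le_sub_one_of_pos (show 0 < L n / 2 by linarith)
    rw [Real.log_div hp.ne' two_ne_zero] at h
    linarith [Real.log_two_lt_d9]
  rw [Real.log_inv, rapidEigenvalue, Real.log_mul hp.ne' (Real.exp_pos _).ne', Real.log_exp]
  linarith

end IsRapid

end Rapid

end NoncommHeat

namespace NoncommHeat

/-! ### Singular values and the Dixmier mean of the diagonal operator. -/

section SingularValue

variable {H : Type*} [NormedAddCommGroup H] [InnerProductSpace ℂ H] [CompleteSpace H]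
variable {N : VonNeumannAlgebra H}

theorem singularValue_nonneg (τ : FNSTrace N) (A : H →L[ℂ] H) (s : ℝ) :
    0 ≤ singularValue τ A s := by
  refine Real.sInf_nonneg ?_
  rintro r ⟨p, -, -, -, rfl⟩
  exact norm_nonneg _

theorem singularValue_antitone (τ : FNSTrace N) (A : H →L[ℂ] H) :
    Antitone (singularValue τ A) := by
  intro s t hst
  refine csInf_le_csInf ⟨0, ?_⟩ ?_ ?_
  · rintro r ⟨p, -, -, -, rfl⟩
    exact norm_nonneg _
  · exact ⟨‖A * 1‖, 1, one_mem N, .one _, by simp [τ.map_zero], rfl⟩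
  · rintro r ⟨p, hp, hpp, hps, rfl⟩
    exact ⟨p, hp, hpp, hps.trans (ENNReal.ofReal_le_ofReal hst), rfl⟩

theorem singularValue_le (τ : FNSTrace N) (A : H →L[ℂ] H) {Q : H →L[ℂ] H} (hQ : Q ∈ N)
    (hQp : IsStarProjection Q) {s : ℝ} (hs : τ.toFun Q ≤ ENNReal.ofReal s) :
    singularValue τ A s ≤ ‖A * (1 - Q)‖ := by
  refine csInf_le ⟨0, ?_⟩ ⟨1 - Q, sub_mem (one_mem N) hQ, hQp.one_sub, by simpa using hs, rfl⟩
  rintro r ⟨p, -, -, -, rfl⟩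
  exact norm_nonneg _

theorem intervalIntegrable_singularValue (τ : FNSTrace N) (A : H →L[ℂ] H) (a b : ℝ) :
    IntervalIntegrable (singularValue τ A) volume a b :=
  (singularValue_antitone τ A).intervalIntegrable

theorem integral_singularValue_nonneg (τ : FNSTrace N) (A : H →L[ℂ] H) {t : ℝ} (ht : 0 ≤ t) :
    0 ≤ ∫ s in (0 : ℝ)..t, singularValue τ A s :=
  intervalIntegral.integral_nonneg ht fun s _ => singularValue_nonneg τ A s

theorem dixmierMean_nonneg (τ : FNSTrace N) (A : H →L[ℂ] H) {t : ℝ} (ht : 0 < t) :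
    0 ≤ dixmierMean τ A t :=
  mul_nonneg (one_div_nonneg.mpr (Real.log_nonneg (by linarith)))
    (integral_singularValue_nonneg τ A ht.le)

theorem memLp_dixmierMean (τ : FNSTrace N) (A : H →L[ℂ] H) {C : ℝ}
    (hC : ∀ t, 0 < t → dixmierMean τ A t ≤ C) : MemLp (dixmierMean τ A) ∞ halfLine := by
  have hmeas : AEStronglyMeasurable (dixmierMean τ A) halfLine := by
    have h1 : Continuous fun t => ∫ s in (0 : ℝ)..t, singularValue τ A s :=
      intervalIntegral.continuous_primitive (intervalIntegrable_singularValue τ A) 0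
    have h2 : Measurable fun t : ℝ => 1 / Real.log (1 + t) := by fun_prop
    exact (h2.mul h1.measurable).aestronglyMeasurable
  refine memLp_top_of_bound hmeas C ?_
  rw [halfLine, ae_restrict_iff' measurableSet_Ioi]
  refine Eventually.of_forall fun t ht => ?_
  rw [Real.norm_of_nonneg (dixmierMean_nonneg τ A ht)]
  exact hC t ht

/-- The trace of the `n`-th projection is `exp (L n)`, where `L` is rapid. -/
structure IsRapidSequence (τ : FNSTrace N) (p : ℕ → H →L[ℂ] H) (L : ℕ → ℝ) : Prop
    extends IsOrthogonalSequence τ p where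
  rapid : IsRapid L
  trace_eq : ∀ n, τ.toFun (p n) = ENNReal.ofReal (Real.exp (L n))

theorem FNSTrace.exists_isRapidSequence (τ : FNSTrace N) (hτ : τ.toFun 1 = ∞) :
    ∃ p L, IsRapidSequence τ p L := by
  obtain ⟨p, hp, hL⟩ := τ.exists_rapid_sequence hτ
  refine ⟨p, _, hp, hL, fun n => ?_⟩
  have hpos : 0 < (τ.toFun (p n)).toReal := by
    by_contra! h
    have h0 : (τ.toFun (p n)).toReal = 0 := le_antisymm h ENNReal.toReal_nonneg
    have := hL.hundred_le n
    simp only [h0, Real.log_zero] at this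
    linarith
  rw [Real.exp_log hpos, ENNReal.ofReal_toReal (hp.finite n)]

namespace IsRapidSequence

variable {τ : FNSTrace N} {p : ℕ → H →L[ℂ] H} {L : ℕ → ℝ}

theorem summable_abs_eigenvalue (h : IsRapidSequence τ p L) :
    Summable fun n => |rapidEigenvalue L n| := by
  simpa only [abs_of_pos (h.rapid.eigenvalue_pos _)] using h.rapid.summable_eigenvalue

theorem sum_exp_le (h : IsRapidSequence τ p L) (m : ℕ) :
    ∑ k ∈ Finset.range m, Real.exp (L k) ≤ Real.exp (L m) := by
  induction m with
  | zero => simpa using (Real.exp_pos _).le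
  | succ m ih =>
    rw [Finset.sum_range_succ]
    have h1 : Real.exp (2 * L m) ≤ Real.exp (L (m + 1)) :=
      Real.exp_le_exp.mpr (h.rapid.two_mul_le_of_lt m.lt_succ_self)
    have h2 : Real.exp (2 * L m) = Real.exp (L m) * Real.exp (L m) := by
      rw [← Real.exp_add, two_mul]
    have h3 : 2 ≤ Real.exp (L m) := by
      linarith [Real.add_one_le_exp (L m), h.rapid.hundred_le m]
    nlinarith

/-- Cut off all blocks with `2 * exp (L k) ≤ s`. The factor `2` absorbs the earlier blocks, since
the last trace exceeds the sum of those before it, so the total trace removed is at most `s`. -/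
theorem singularValue_diagonal_le (h : IsRapidSequence τ p L) {s : ℝ} (hs : 0 ≤ s) :
    singularValue τ (diagonal p (rapidEigenvalue L)) s ≤
      ∑' k, if s < 2 * Real.exp (L k) then rapidEigenvalue L k else 0 := by
  have hpos := fun n => (h.rapid.eigenvalue_pos n).le
  have hmono : Monotone L := monotone_nat_of_le_succ fun n => by
    linarith [h.rapid.two_mul_le_of_lt n.lt_succ_self, h.rapid.pos n]
  have hex : ∃ m, s < 2 * Real.exp (L m) := by
    obtain ⟨m, hm⟩ := ((Real.tendsto_exp_atTop.comp h.rapid.tendsto).eventually_gt_atTop s).exists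
    exact ⟨m, by linarith [show s < Real.exp (L m) from hm, Real.exp_pos (L m)]⟩
  classical
  set m := Nat.find hex with hm
  have hlt : ∀ k, m ≤ k → s < 2 * Real.exp (L k) := fun k hk =>
    (Nat.find_spec hex).trans_le (by gcongr; exact hmono hk)
  have hge : ∀ k, k < m → ¬ s < 2 * Real.exp (L k) := fun k hk => Nat.find_min hex hk
  have hD : ∑ k ∈ Finset.range m, Real.exp (L k) ≤ s := by
    rcases m.eq_zero_or_pos with h0 | h0
    · rw [h0]; simpa using hs
    · obtain ⟨j, hj⟩ := Nat.exists_eq_succ_of_ne_zero h0.ne'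
      have h1 := not_lt.mp (hge j (by omega))
      rw [hj, Finset.sum_range_succ]
      linarith [h.sum_exp_le j]
  have htr : τ.toFun (∑ k ∈ Finset.range m, p k) ≤ ENNReal.ofReal s := by
    rw [τ.map_sum _ _ h.mem fun k => (h.proj k).nonneg]
    simp only [h.trace_eq]
    rw [← ENNReal.ofReal_sum_of_nonneg fun k _ => (Real.exp_pos _).le]
    exact ENNReal.ofReal_le_ofReal hD
  have hsum : Summable fun k => if s < 2 * Real.exp (L k) then rapidEigenvalue L k else 0 :=
    Summable.of_nonneg_of_le (fun k => by split_ifs <;> simp [hpos])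
      (fun k => by split_ifs <;> simp [hpos]) h.rapid.summable_eigenvalue
  refine (singularValue_le τ _ (sum_mem fun k _ => h.mem k) (h.sum_proj m) htr).trans
    ((h.norm_diagonal_mul_le h.summable_abs_eigenvalue hpos m).trans ?_)
  rw [← hsum.sum_add_tsum_nat_add m, Finset.sum_eq_zero fun k hk =>
    if_neg (hge k (Finset.mem_range.mp hk)), zero_add]
  exact le_of_eq (tsum_congr fun k => (if_pos (hlt _ (Nat.le_add_left _ _))).symm)

theorem integral_singularValue_le (h : IsRapidSequence τ p L) {t : ℝ} (ht : 0 ≤ t) :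
    ∫ s in (0 : ℝ)..t, singularValue τ (diagonal p (rapidEigenvalue L)) s ≤
      ∑' k, rapidEigenvalue L k * min t (2 * Real.exp (L k)) := by
  set A := diagonal p (rapidEigenvalue L)
  have hpos := fun n => (h.rapid.eigenvalue_pos n).le
  have hmin : ∀ k, 0 ≤ min t (2 * Real.exp (L k)) := fun k => le_min ht (by positivity)
  have hterm : ∀ k, 0 ≤ rapidEigenvalue L k * min t (2 * Real.exp (L k)) := fun k =>
    mul_nonneg (hpos k) (hmin k)
  rw [← ENNReal.ofReal_le_ofReal_iff (tsum_nonneg hterm), intervalIntegral.integral_of_le ht,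
    ofReal_integral_eq_lintegral_ofReal
      ((intervalIntegrable_iff_integrableOn_Ioc_of_le ht).mp
        (intervalIntegrable_singularValue τ A 0 t))
      (Eventually.of_forall fun s => singularValue_nonneg τ A s),
    ENNReal.ofReal_tsum_of_nonneg hterm (h.rapid.summable_eigenvalue_mul_min ht)]
  have hle : ∀ s ∈ Set.Ioc (0 : ℝ) t, ENNReal.ofReal (singularValue τ A s) ≤
      ∑' k, (Set.Iio (2 * Real.exp (L k))).indicator
        (fun _ => ENNReal.ofReal (rapidEigenvalue L k)) s := by
    intro s hs
    have hnn : ∀ k, 0 ≤ if s < 2 * Real.exp (L k) then rapidEigenvalue L k else 0 := fun k => by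
      split_ifs <;> simp [hpos]
    have hsum : Summable fun k => if s < 2 * Real.exp (L k) then rapidEigenvalue L k else 0 :=
      Summable.of_nonneg_of_le hnn
        (fun k => by split_ifs <;> simp [hpos]) h.rapid.summable_eigenvalue
    refine (ENNReal.ofReal_le_ofReal (h.singularValue_diagonal_le hs.1.le)).trans ?_
    rw [ENNReal.ofReal_tsum_of_nonneg hnn hsum]
    refine le_of_eq (tsum_congr fun k => ?_)
    by_cases hk : s < 2 * Real.exp (L k) <;> simp [hk]
  calc ∫⁻ s in Set.Ioc 0 t, ENNReal.ofReal (singularValue τ A s)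
      ≤ ∫⁻ s in Set.Ioc 0 t, ∑' k, (Set.Iio (2 * Real.exp (L k))).indicator
        (fun _ => ENNReal.ofReal (rapidEigenvalue L k)) s :=
        setLIntegral_mono' measurableSet_Ioc hle
    _ = ∑' k, ∫⁻ s in Set.Ioc 0 t, (Set.Iio (2 * Real.exp (L k))).indicator
        (fun _ => ENNReal.ofReal (rapidEigenvalue L k)) s :=
        lintegral_tsum fun k => (measurable_const.indicator measurableSet_Iio).aemeasurable
    _ ≤ ∑' k, ENNReal.ofReal (rapidEigenvalue L k * min t (2 * Real.exp (L k))) := by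
        refine ENNReal.tsum_le_tsum fun k => ?_
        rw [lintegral_indicator measurableSet_Iio, lintegral_const, Measure.restrict_apply_univ,
          Measure.restrict_apply measurableSet_Iio, ENNReal.ofReal_mul (hpos k)]
        gcongr
        calc volume (Set.Iio (2 * Real.exp (L k)) ∩ Set.Ioc 0 t)
            ≤ volume (Set.Icc 0 (min t (2 * Real.exp (L k)))) :=
              measure_mono fun s hs => ⟨hs.2.1.le, le_min hs.2.2 (le_of_lt hs.1)⟩
          _ = _ := by rw [Real.volume_Icc, sub_zero]

theorem exists_dixmierMean_le (h : IsRapidSequence τ p L) :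
    ∃ C, ∀ t, 0 < t → dixmierMean τ (diagonal p (rapidEigenvalue L)) t ≤ C := by
  refine ⟨2 * (4 + ∑' k, L k ^ 2 * Real.exp (-(L k / 2))), fun t ht => ?_⟩
  have hlog : 0 < Real.log (1 + t) := Real.log_pos (by linarith)
  rw [dixmierMean, one_div, inv_mul_le_iff₀ hlog, mul_comm]
  exact (h.integral_singularValue_le ht.le).trans (h.rapid.tsum_eigenvalue_mul_min_le ht)

/-- On the window `log (1 + t)` is at least `L n / 2`, while the integral is of order `√(L n)`. -/
theorem dixmierMean_le_of_window (h : IsRapidSequence τ p L) (n : ℕ) {t : ℝ}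
    (h1 : (rapidEigenvalue L n)⁻¹ ≤ t) (h2 : rapidEigenvalue L n * t ≤ √(L n)) :
    dixmierMean τ (diagonal p (rapidEigenvalue L)) t ≤
      6 * (√(L n))⁻¹ + 2 * (∑' k, L k ^ 2 * Real.exp (-(L k / 2))) * (L n)⁻¹ := by
  have hp := h.rapid.pos n
  have hinv : 0 < (rapidEigenvalue L n)⁻¹ := inv_pos.mpr (h.rapid.eigenvalue_pos n)
  have ht : 0 < t := hinv.trans_le h1
  have hlog : L n / 2 ≤ Real.log (1 + t) :=
    (h.rapid.log_inv_eigenvalue_ge n).trans (Real.log_le_log hinv (by linarith))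
  have hI := (h.integral_singularValue_le ht.le).trans
    (h.rapid.tsum_eigenvalue_mul_min_le_of_window n ht.le h2)
  have hI0 := integral_singularValue_nonneg τ (diagonal p (rapidEigenvalue L)) ht.le
  set W := ∑' k, L k ^ 2 * Real.exp (-(L k / 2))
  have hsq : √(L n) * (L n)⁻¹ = (√(L n))⁻¹ := by
    have hs : 0 < √(L n) := Real.sqrt_pos.mpr hp
    have : L n = √(L n) * √(L n) := (Real.mul_self_sqrt hp.le).symm
    conv_lhs => arg 2; rw [this]
    field_simp
  calc dixmierMean τ (diagonal p (rapidEigenvalue L)) t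
      ≤ 1 / (L n / 2) * (3 * √(L n) + W) := by
        rw [dixmierMean]
        gcongr
    _ = 6 * (√(L n) * (L n)⁻¹) + 2 * W * (L n)⁻¹ := by field_simp; ring
    _ = _ := by rw [hsq]

end IsRapidSequence

end SingularValue

end NoncommHeat

namespace NoncommHeat

/-! ### Scalar bounds for the heat profile. -/

section HeatProfile

/-- The quadratic vanishing at `0` makes the traces finite; after division by `t ^ 2` the majorant
is a Lorentzian, integrable in closed form. -/
theorem exists_exp_neg_rpow_le {q : ℝ} (hq : 0 < q) :
    ∃ C : ℝ, 0 < C ∧ ∀ x : ℝ, 0 < x → Real.exp (-x ^ (-q)) ≤ C * (x ^ 2 / (1 + x ^ 2)) := by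
  -- Chosen so that `(x ^ (-q)) ^ m` dominates `x ^ (-2)` for `x ≤ 1`; the exponential series then
  -- supplies the factor `m!`.
  set m := ⌈2 / q⌉₊ with hm
  have hm1 : (1 : ℝ) ≤ (m.factorial : ℝ) := by exact_mod_cast Nat.factorial_pos m
  refine ⟨2 * m.factorial, by positivity, fun x hx => ?_⟩
  rw [mul_div_assoc', le_div_iff₀ (by positivity)]
  have hy : 0 < x ^ (-q) := Real.rpow_pos_of_pos hx _
  rcases le_total 1 x with h | h
  · have h1 : Real.exp (-x ^ (-q)) ≤ 1 := Real.exp_le_one_iff.mpr (by linarith)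
    nlinarith [Real.exp_pos (-x ^ (-q))]
  · have hy1 : 1 ≤ x ^ (-q) := Real.one_le_rpow_of_pos_of_le_one_of_nonpos hx h (by linarith)
    have h1 : (x ^ 2)⁻¹ ≤ (x ^ (-q)) ^ m := by
      have h2 : (x ^ (-q)) ^ (2 / q) = (x ^ 2)⁻¹ := by
        rw [← Real.rpow_mul hx.le, show -q * (2 / q) = -(2 : ℝ) by field_simp, Real.rpow_neg hx.le,
          Real.rpow_two]
      rw [← h2, ← Real.rpow_natCast]
      exact Real.rpow_le_rpow_of_exponent_le hy1 (Nat.le_ceil _)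
    have h2 := Real.pow_div_factorial_le_exp _ hy.le m
    have h3 : (x ^ 2)⁻¹ ≤ Real.exp (x ^ (-q)) * m.factorial :=
      h1.trans ((div_le_iff₀ (by positivity)).mp h2)
    have h4 : Real.exp (-x ^ (-q)) ≤ m.factorial * x ^ 2 := by
      rw [Real.exp_neg, inv_le_iff_one_le_mul₀ (Real.exp_pos _)]
      rw [inv_le_iff_one_le_mul₀ (by positivity)] at h3
      linarith
    have h5 : x ^ 2 ≤ 1 := by nlinarith
    nlinarith [Real.exp_pos (-x ^ (-q))]

theorem heatProfile_nonneg (q t u : ℝ) : 0 ≤ heatProfile q t u := by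
  rw [heatProfile]
  split_ifs
  exacts [le_rfl, (Real.exp_pos _).le]

theorem heatProfile_of_pos (q t : ℝ) {u : ℝ} (hu : 0 < u) :
    heatProfile q t u = Real.exp (-(t * u) ^ (-q)) := if_neg hu.not_ge

theorem heatProfile_mono {q s t : ℝ} (hq : 0 < q) (hs : 0 < s) (hst : s ≤ t) (u : ℝ) :
    heatProfile q s u ≤ heatProfile q t u := by
  rcases le_or_gt u 0 with hu | hu
  · rw [heatProfile, heatProfile, if_pos hu, if_pos hu]
  · rw [heatProfile_of_pos q s hu, heatProfile_of_pos q t hu]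
    refine Real.exp_le_exp.mpr (neg_le_neg ?_)
    exact Real.rpow_le_rpow_of_nonpos (mul_pos hs hu) (by gcongr) (by linarith)

theorem heatProfile_le {q C : ℝ} (hC : 0 < C)
    (h : ∀ x : ℝ, 0 < x → Real.exp (-x ^ (-q)) ≤ C * (x ^ 2 / (1 + x ^ 2))) {t : ℝ} (ht : 0 < t)
    (u : ℝ) : heatProfile q t u ≤ C * ((t * u) ^ 2 / (1 + (t * u) ^ 2)) := by
  rcases le_or_gt u 0 with hu | hu
  · rw [heatProfile, if_pos hu]
    positivity
  · rw [heatProfile_of_pos q t hu]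
    exact h _ (mul_pos ht hu)

theorem abs_heatProfile_le {q C : ℝ} (hC : 0 < C)
    (h : ∀ x : ℝ, 0 < x → Real.exp (-x ^ (-q)) ≤ C * (x ^ 2 / (1 + x ^ 2))) {t : ℝ} (ht : 0 < t)
    (u : ℝ) : |heatProfile q t u| ≤ C * t ^ 2 * u ^ 2 := by
  rw [abs_of_nonneg (heatProfile_nonneg q t u), mul_assoc, ← mul_pow]
  refine (heatProfile_le hC h ht u).trans ?_
  gcongr
  exact div_le_self (sq_nonneg _) (by nlinarith [sq_nonneg (t * u)])

theorem continuous_heatProfile {q t : ℝ} (hq : 0 < q) (ht : 0 < t) :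
    Continuous (heatProfile q t) := by
  obtain ⟨C, hC, h⟩ := exists_exp_neg_rpow_le hq
  rw [continuous_iff_continuousAt]
  intro u
  rcases lt_trichotomy u 0 with hu | rfl | hu
  · refine (continuousAt_const (y := (0 : ℝ))).congr ?_
    filter_upwards [gt_mem_nhds hu] with v hv
    rw [heatProfile, if_pos (le_of_lt hv)]
  · rw [ContinuousAt, show heatProfile q t 0 = 0 from if_pos le_rfl]
    refine squeeze_zero_norm (abs_heatProfile_le hC h ht) ?_
    have : Continuous fun u : ℝ => C * t ^ 2 * u ^ 2 := by fun_prop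
    simpa using this.tendsto 0
  · have hc : ContinuousAt (fun v : ℝ => Real.exp (-(t * v) ^ (-q))) u := by
      refine Real.continuous_exp.continuousAt.comp (ContinuousAt.neg ?_)
      exact (continuousAt_const.mul continuousAt_id).rpow_const (Or.inl (mul_pos ht hu).ne')
    refine hc.congr ?_
    filter_upwards [lt_mem_nhds hu] with v hv
    rw [heatProfile_of_pos q t hv]

theorem integral_lorentz_le {L a T : ℝ} (hL : 0 ≤ L) (ha : 0 < a) (hT : 0 ≤ T) :
    ∫ s in (1 : ℝ)..T, L * a / (1 + (a * s) ^ 2) ≤ 2 * (L * min 1 (a * T)) := by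
  have hd : ∀ s : ℝ, HasDerivAt (fun s => L * Real.arctan (a * s)) (L * a / (1 + (a * s) ^ 2)) s := by
    intro s
    have h1 : HasDerivAt (fun s : ℝ => a * s) a s := by
      simpa using (hasDerivAt_id s).const_mul a
    exact (h1.arctan.const_mul L).congr_deriv (by ring)
  have hcont : Continuous fun s : ℝ => L * a / (1 + (a * s) ^ 2) := by
    refine Continuous.div (by fun_prop) (by fun_prop) fun s => ?_
    positivity
  rw [intervalIntegral.integral_eq_sub_of_hasDerivAt (fun s _ => hd s)
    (hcont.intervalIntegrable _ _)]
  have h0 : 0 ≤ L * Real.arctan (a * 1) := mul_nonneg hL (Real.arctan_nonneg.mpr (by linarith))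
  have h1 : Real.arctan (a * T) ≤ 2 := by
    linarith [Real.arctan_lt_pi_div_two (a * T), Real.pi_le_four]
  have h2 : Real.arctan (a * T) ≤ a * T := by
    have h := Real.le_tan (Real.arctan_nonneg.mpr (mul_nonneg ha.le hT))
      (Real.arctan_lt_pi_div_two (a * T))
    rwa [Real.tan_arctan] at h
  have h3 : Real.arctan (a * T) ≤ 2 * min 1 (a * T) := by
    rcases le_total 1 (a * T) with h | h
    · rw [min_eq_left h]; linarith
    · rw [min_eq_right h]; nlinarith [mul_nonneg ha.le hT]
  nlinarith

end HeatProfile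

/-! ### The heat kernel and its Cesàro mean. -/

section HeatKernel

variable {H : Type*} [NormedAddCommGroup H] [InnerProductSpace ℂ H] [CompleteSpace H]
variable {N : VonNeumannAlgebra H}

namespace IsRapidSequence

variable {τ : FNSTrace N} {p : ℕ → H →L[ℂ] H} {L : ℕ → ℝ} {q : ℝ}

theorem eigenvalue_sq_mul_exp (n : ℕ) :
    rapidEigenvalue L n ^ 2 * Real.exp (L n) = L n * rapidEigenvalue L n := by
  rw [sq, mul_assoc, IsRapid.eigenvalue_mul_exp, mul_comm]

theorem summable_heatProfile (h : IsRapidSequence τ p L) (hq : 0 < q) {t : ℝ} (ht : 0 < t) :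
    Summable fun n => heatProfile q t (rapidEigenvalue L n) * Real.exp (L n) := by
  obtain ⟨C, hC, hb⟩ := exists_exp_neg_rpow_le hq
  refine Summable.of_nonneg_of_le
    (fun n => mul_nonneg (heatProfile_nonneg _ _ _) (Real.exp_pos _).le) (fun n => ?_)
    (h.rapid.summable_mul_eigenvalue.mul_left (C * t ^ 2))
  calc _ ≤ C * t ^ 2 * rapidEigenvalue L n ^ 2 * Real.exp (L n) := by
        gcongr
        exact (le_abs_self _).trans (abs_heatProfile_le hC hb ht _)
    _ = _ := by rw [mul_assoc, eigenvalue_sq_mul_exp]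

theorem trace_heatOperator (h : IsRapidSequence τ p L) (hq : 0 < q) {t : ℝ} (ht : 0 < t) :
    τ.toFun (heatOperator q (diagonal p (rapidEigenvalue L)) t) =
      ENNReal.ofReal (∑' n, heatProfile q t (rapidEigenvalue L n) * Real.exp (L n)) := by
  obtain ⟨C, hC, hb⟩ := exists_exp_neg_rpow_le hq
  obtain ⟨hs, heq⟩ := h.cfc_diagonal h.summable_abs_eigenvalue
    (fun n => (h.rapid.eigenvalue_pos n).le) (continuous_heatProfile hq ht)
    (abs_heatProfile_le hC hb ht)
  rw [heatOperator, heq, h.trace_diagonal hs (fun n => heatProfile_nonneg _ _ _),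
    ENNReal.ofReal_tsum_of_nonneg
      (fun n => mul_nonneg (heatProfile_nonneg _ _ _) (Real.exp_pos _).le)
      (h.summable_heatProfile hq ht)]
  refine tsum_congr fun n => ?_
  rw [h.trace_eq, ENNReal.ofReal_mul (heatProfile_nonneg _ _ _)]

theorem toReal_trace_heatOperator (h : IsRapidSequence τ p L) (hq : 0 < q) {t : ℝ} (ht : 0 < t) :
    (τ.toFun (heatOperator q (diagonal p (rapidEigenvalue L)) t)).toReal =
      ∑' n, heatProfile q t (rapidEigenvalue L n) * Real.exp (L n) := by
  rw [h.trace_heatOperator hq ht, ENNReal.toReal_ofReal]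
  exact tsum_nonneg fun n => mul_nonneg (heatProfile_nonneg _ _ _) (Real.exp_pos _).le

theorem heatKernel_div_eq (h : IsRapidSequence τ p L) (hq : 0 < q) {t : ℝ} (ht : 0 < t) :
    heatKernel τ q (diagonal p (rapidEigenvalue L)) t / t =
      (t ^ 2)⁻¹ * ∑' n, heatProfile q t (rapidEigenvalue L n) * Real.exp (L n) := by
  rw [heatKernel, h.toReal_trace_heatOperator hq ht]
  field_simp

theorem heatKernel_div_nonneg (τ : FNSTrace N) (q : ℝ) (A : H →L[ℂ] H) (t : ℝ) :
    0 ≤ heatKernel τ q A t / t := by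
  have : heatKernel τ q A t / t = (t ^ 2)⁻¹ * (τ.toFun (heatOperator q A t)).toReal := by
    rw [heatKernel, sq, mul_inv]
    ring
  rw [this]
  positivity

/-- The trace of the heat operator is monotone in `t`. -/
theorem aemeasurable_heatKernel (h : IsRapidSequence τ p L) (hq : 0 < q) :
    AEMeasurable (heatKernel τ q (diagonal p (rapidEigenvalue L)))
      (volume.restrict (Set.Ioi 0)) := by
  have hmono : MonotoneOn
      (fun t => (τ.toFun (heatOperator q (diagonal p (rapidEigenvalue L)) t)).toReal)
      (Set.Ioi 0) := by
    intro s hs t ht hst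
    simp only [h.toReal_trace_heatOperator hq hs, h.toReal_trace_heatOperator hq ht]
    refine (h.summable_heatProfile hq hs).tsum_le_tsum (fun n => ?_) (h.summable_heatProfile hq ht)
    gcongr
    exact heatProfile_mono hq hs hst _
  have h1 : Measurable fun t : ℝ => 1 / t := by fun_prop
  exact h1.aemeasurable.mul (aemeasurable_restrict_of_monotoneOn measurableSet_Ioi hmono)

theorem exists_heatKernel_div_le (h : IsRapidSequence τ p L) (hq : 0 < q) :
    ∃ C : ℝ, 0 < C ∧ ∀ t, 0 < t → heatKernel τ q (diagonal p (rapidEigenvalue L)) t / t ≤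
      ∑' k, C * (L k * rapidEigenvalue L k / (1 + (rapidEigenvalue L k * t) ^ 2)) := by
  obtain ⟨C, hC, hb⟩ := exists_exp_neg_rpow_le hq
  refine ⟨C, hC, fun t ht => ?_⟩
  rw [h.heatKernel_div_eq hq ht, ← tsum_mul_left]
  have hs := (h.summable_heatProfile hq ht).mul_left (t ^ 2)⁻¹
  refine hs.tsum_le_tsum (fun k => ?_) ?_
  · rw [← eigenvalue_sq_mul_exp]
    calc _ ≤ (t ^ 2)⁻¹ * (C * ((t * rapidEigenvalue L k) ^ 2 /
          (1 + (t * rapidEigenvalue L k) ^ 2)) * Real.exp (L k)) := by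
          gcongr
          exact heatProfile_le hC hb ht _
      _ = _ := by
          rw [mul_comm t]
          field_simp
  · refine Summable.mul_left _ (Summable.of_nonneg_of_le (fun k => ?_) (fun k => ?_)
      h.rapid.summable_mul_eigenvalue)
    · have := h.rapid.pos k
      have := h.rapid.eigenvalue_pos k
      positivity
    · have := h.rapid.pos k
      have := h.rapid.eigenvalue_pos k
      exact div_le_self (by positivity) (by nlinarith [sq_nonneg (rapidEigenvalue L k * t)])

theorem exists_heatKernel_div_le_const (h : IsRapidSequence τ p L) (hq : 0 < q) :
    ∃ V : ℝ, 0 ≤ V ∧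
      ∀ t, 0 < t → heatKernel τ q (diagonal p (rapidEigenvalue L)) t / t ≤ V := by
  obtain ⟨C, hC, hb⟩ := h.exists_heatKernel_div_le hq
  have hpos : ∀ k, 0 < L k * rapidEigenvalue L k := fun k =>
    mul_pos (h.rapid.pos k) (h.rapid.eigenvalue_pos k)
  have hle : ∀ t k, C * (L k * rapidEigenvalue L k / (1 + (rapidEigenvalue L k * t) ^ 2)) ≤
      C * (L k * rapidEigenvalue L k) := fun t k => by
    gcongr
    exact div_le_self (hpos k).le (by nlinarith [sq_nonneg (rapidEigenvalue L k * t)])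
  have hs := h.rapid.summable_mul_eigenvalue.mul_left C
  refine ⟨∑' k, C * (L k * rapidEigenvalue L k), tsum_nonneg fun k => ?_, fun t ht =>
    (hb t ht).trans (Summable.tsum_le_tsum (hle t) ?_ hs)⟩
  · exact mul_nonneg hC.le (hpos k).le
  · refine Summable.of_nonneg_of_le (fun k => ?_) (hle t) hs
    have := hpos k
    positivity

theorem integrableOn_heatKernel_div (h : IsRapidSequence τ p L) (hq : 0 < q) {s : Set ℝ}
    (hs : s ⊆ Set.Ioi 0) (hsm : MeasurableSet s) (hfin : volume s ≠ ∞) :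
    IntegrableOn (fun t => heatKernel τ q (diagonal p (rapidEigenvalue L)) t / t) s := by
  obtain ⟨V, -, hV⟩ := h.exists_heatKernel_div_le_const hq
  have : IsFiniteMeasure (volume.restrict s) := ⟨by simpa using hfin.lt_top⟩
  refine Integrable.of_bound ?_ V ?_
  · exact ((h.aemeasurable_heatKernel hq).mono_measure
      (Measure.restrict_mono hs le_rfl)).div aemeasurable_id |>.aestronglyMeasurable
  · rw [ae_restrict_iff' hsm]
    refine Eventually.of_forall fun t ht => ?_
    rw [Real.norm_of_nonneg (heatKernel_div_nonneg τ q _ t)]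
    exact hV t (hs ht)

theorem intervalIntegrable_heatKernel_div (h : IsRapidSequence τ p L) (hq : 0 < q) {a b : ℝ}
    (ha : 0 < a) (hb : 0 < b) : IntervalIntegrable
      (fun t => heatKernel τ q (diagonal p (rapidEigenvalue L)) t / t) volume a b := by
  rw [intervalIntegrable_iff]
  refine h.integrableOn_heatKernel_div hq (fun t ht => ?_) measurableSet_uIoc (by simp)
  exact (lt_min ha hb).trans ht.1

theorem locallyIntegrableOn_heatKernel (h : IsRapidSequence τ p L) (hq : 0 < q) :
    LocallyIntegrableOn (heatKernel τ q (diagonal p (rapidEigenvalue L))) (Set.Ioi 0) := by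
  rw [locallyIntegrableOn_iff isOpen_Ioi.isLocallyClosed]
  intro k hk hkc
  have h1 := h.integrableOn_heatKernel_div hq hk hkc.measurableSet hkc.measure_lt_top.ne
  have h2 := h1.mul_continuousOn (g' := fun t => t) continuousOn_id hkc
  refine h2.congr_fun (fun t ht => ?_) hkc.measurableSet
  exact div_mul_cancel₀ _ (ne_of_gt (hk ht))

/-- Integrating the Lorentzian majorants term by term leads back to the sum in `tsum_mul_min_le`. -/
theorem exists_integral_heatKernel_div_le (h : IsRapidSequence τ p L) (hq : 0 < q) :
    ∃ C : ℝ, ∀ T, 1 ≤ T → ∫ s in (1 : ℝ)..T,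
      heatKernel τ q (diagonal p (rapidEigenvalue L)) s / s ≤ C * Real.log (1 + T) := by
  obtain ⟨C, hC, hb⟩ := h.exists_heatKernel_div_le hq
  refine ⟨C * (2 * (4 + ∑' k, L k ^ 2 * Real.exp (-(L k / 2)))), fun T hT => ?_⟩
  have hT0 : 0 < T := by linarith
  have hpos : ∀ k, 0 < L k * rapidEigenvalue L k := fun k =>
    mul_pos (h.rapid.pos k) (h.rapid.eigenvalue_pos k)
  have hterm : ∀ k, 0 ≤ C * (2 * (L k * min 1 (rapidEigenvalue L k * T))) := fun k =>
    mul_nonneg hC.le (mul_nonneg zero_le_two (mul_nonneg (h.rapid.pos k).le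
      (le_min zero_le_one (mul_pos (h.rapid.eigenvalue_pos k) hT0).le)))
  have hsum : Summable fun k => C * (2 * (L k * min 1 (rapidEigenvalue L k * T))) :=
    ((h.rapid.summable_mul_min hT0.le).mul_left 2).mul_left C
  have hwnn : ∀ s k, 0 ≤ C * (L k * rapidEigenvalue L k / (1 + (rapidEigenvalue L k * s) ^ 2)) :=
    fun s k => by have := hpos k; positivity
  have hwc : ∀ k, Continuous fun s : ℝ =>
      C * (L k * rapidEigenvalue L k / (1 + (rapidEigenvalue L k * s) ^ 2)) := fun k => by
    refine continuous_const.mul (Continuous.div (by fun_prop) (by fun_prop) fun s => ?_)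
    positivity
  have hwsum : ∀ s, Summable fun k =>
      C * (L k * rapidEigenvalue L k / (1 + (rapidEigenvalue L k * s) ^ 2)) := fun s => by
    refine Summable.of_nonneg_of_le (hwnn s) (fun k => ?_)
      (h.rapid.summable_mul_eigenvalue.mul_left C)
    gcongr
    exact div_le_self (hpos k).le (by nlinarith [sq_nonneg (rapidEigenvalue L k * s)])
  suffices hmain : ∫ s in (1 : ℝ)..T, heatKernel τ q (diagonal p (rapidEigenvalue L)) s / s ≤
      ∑' k, C * (2 * (L k * min 1 (rapidEigenvalue L k * T))) by
    refine hmain.trans ?_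
    rw [tsum_mul_left, tsum_mul_left, mul_assoc, mul_assoc]
    gcongr
    exact h.rapid.tsum_mul_min_le hT0
  rw [← ENNReal.ofReal_le_ofReal_iff (tsum_nonneg hterm), intervalIntegral.integral_of_le hT,
    ofReal_integral_eq_lintegral_ofReal
      ((intervalIntegrable_iff_integrableOn_Ioc_of_le hT).mp
        (h.intervalIntegrable_heatKernel_div hq one_pos hT0))
      (Eventually.of_forall fun s => heatKernel_div_nonneg τ q _ s),
    ENNReal.ofReal_tsum_of_nonneg hterm hsum]
  calc ∫⁻ s in Set.Ioc 1 T, ENNReal.ofReal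
        (heatKernel τ q (diagonal p (rapidEigenvalue L)) s / s)
      ≤ ∫⁻ s in Set.Ioc 1 T, ∑' k, ENNReal.ofReal
        (C * (L k * rapidEigenvalue L k / (1 + (rapidEigenvalue L k * s) ^ 2))) := by
        refine setLIntegral_mono' measurableSet_Ioc fun s hs => ?_
        rw [← ENNReal.ofReal_tsum_of_nonneg (hwnn s) (hwsum s)]
        exact ENNReal.ofReal_le_ofReal (hb s (one_pos.trans hs.1))
    _ = ∑' k, ∫⁻ s in Set.Ioc 1 T, ENNReal.ofReal
        (C * (L k * rapidEigenvalue L k / (1 + (rapidEigenvalue L k * s) ^ 2))) :=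
        lintegral_tsum fun k => (hwc k).measurable.ennreal_ofReal.aemeasurable
    _ ≤ _ := by
        refine ENNReal.tsum_le_tsum fun k => ?_
        rw [← ofReal_integral_eq_lintegral_ofReal
          ((intervalIntegrable_iff_integrableOn_Ioc_of_le hT).mp ((hwc k).intervalIntegrable 1 T))
          (Eventually.of_forall fun s => hwnn s k), ← intervalIntegral.integral_of_le hT,
          intervalIntegral.integral_const_mul]
        gcongr
        exact integral_lorentz_le (h.rapid.pos k).le (h.rapid.eigenvalue_pos k) hT0.le

theorem memLp_cesaro_heatKernel (h : IsRapidSequence τ p L) (hq : 0 < q) :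
    MemLp (cesaro (heatKernel τ q (diagonal p (rapidEigenvalue L)))) ∞ halfLine := by
  obtain ⟨C, hC⟩ := h.exists_integral_heatKernel_div_le hq
  obtain ⟨V, hV0, hV⟩ := h.exists_heatKernel_div_le_const hq
  set k := fun s => heatKernel τ q (diagonal p (rapidEigenvalue L)) s / s with hk
  have hknn : ∀ s, 0 ≤ k s := heatKernel_div_nonneg τ q _
  have hmono : MonotoneOn (fun T => ∫ s in (1 : ℝ)..T, k s) (Set.Ioi 0) := by
    intro a ha b hb hab
    have h1 := intervalIntegral.integral_add_adjacent_intervals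
      (h.intervalIntegrable_heatKernel_div hq one_pos ha)
      (h.intervalIntegrable_heatKernel_div hq ha hb)
    have h2 : 0 ≤ ∫ s in a..b, k s := intervalIntegral.integral_nonneg hab fun s _ => hknn s
    have h3 : (∫ s in (1 : ℝ)..a, k s) + ∫ s in a..b, k s = ∫ s in (1 : ℝ)..b, k s := h1
    simp only
    linarith
  have hmeas : AEStronglyMeasurable
      (cesaro (heatKernel τ q (diagonal p (rapidEigenvalue L)))) halfLine := by
    have h1 : Measurable fun t : ℝ => 1 / Real.log t := by fun_prop
    exact (h1.aemeasurable.mul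
      (aemeasurable_restrict_of_monotoneOn measurableSet_Ioi hmono)).aestronglyMeasurable
  refine memLp_top_of_bound hmeas (max (2 * V) (2 * C)) ?_
  rw [halfLine, ae_restrict_iff' measurableSet_Ioi]
  refine Eventually.of_forall fun T (hT : 0 < T) => ?_
  rw [cesaro, norm_mul, Real.norm_eq_abs, abs_div, abs_one]
  -- Near `T = 1` the factor `1 / log T` blows up and is offset by `|T - 1| ≤ 2 * |log T|`; at `T =
  -- 1` itself the quotient is `0` by convention.
  rcases le_total T 2 with h2 | h2
  · refine le_trans ?_ (le_max_left _ _)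
    have hJ : ‖∫ s in (1 : ℝ)..T, k s‖ ≤ V * |T - 1| := by
      refine intervalIntegral.norm_integral_le_of_norm_le_const fun s hs => ?_
      rw [Real.norm_of_nonneg (hknn s)]
      exact hV s ((lt_min one_pos hT).trans hs.1)
    have hlog : |T - 1| ≤ 2 * |Real.log T| := by
      rcases le_total T 1 with h1 | h1
      · rw [abs_of_nonpos (by linarith), abs_of_nonpos (Real.log_nonpos hT.le h1)]
        linarith [Real.log_le_sub_one_of_pos hT]
      · rw [abs_of_nonneg (by linarith), abs_of_nonneg (Real.log_nonneg h1)]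
        have h3 := Real.one_sub_inv_le_log_of_pos hT
        have h4 : T - 1 = T * (1 - T⁻¹) := by field_simp
        have h5 : 0 ≤ Real.log T := Real.log_nonneg h1
        nlinarith
    rcases (abs_nonneg (Real.log T)).eq_or_lt with h0 | h0
    · rw [← h0, div_zero, zero_mul]
      positivity
    · rw [one_div, inv_mul_le_iff₀ h0]
      refine hJ.trans ?_
      nlinarith [mul_le_mul_of_nonneg_left hlog hV0]
  · refine le_trans ?_ (le_max_right _ _)
    have hlogpos : 0 < Real.log T := Real.log_pos (by linarith)
    have hJ0 : 0 ≤ ∫ s in (1 : ℝ)..T, k s :=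
      intervalIntegral.integral_nonneg (by linarith) fun s _ => hknn s
    have hJ := hC T (by linarith)
    rw [Real.norm_of_nonneg hJ0, abs_of_pos hlogpos, one_div, inv_mul_le_iff₀ hlogpos]
    have hlog1 : Real.log (1 + T) ≤ 2 * Real.log T := by
      rw [← Real.log_rpow hT, Real.rpow_two]
      exact Real.log_le_log (by linarith) (by nlinarith)
    have hlog0 : 0 < Real.log (1 + T) := Real.log_pos (by linarith)
    have hC0 : 0 ≤ C := by
      by_contra! hneg
      have := mul_neg_of_neg_of_pos hneg hlog0
      linarith [show (∫ s in (1 : ℝ)..T, k s) ≤ C * Real.log (1 + T) from hJ]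
    calc _ ≤ C * Real.log (1 + T) := hJ
      _ ≤ C * (2 * Real.log T) := by gcongr
      _ = _ := by ring

/-- Block `n` alone suffices. For `s` in `[a⁻¹, 2 * a⁻¹]` its profile is at least `exp (-1)` and `(s
^ 2)⁻¹ ≥ a ^ 2 / 4`; integrating over length `a⁻¹` gives `exp (-1) / 4 * L n`, and `log T ≤ L n`. -/
theorem le_cesaro_heatKernel_of_window (h : IsRapidSequence τ p L) (hq : 0 < q) (n : ℕ) {T : ℝ}
    (h1 : 2 * (rapidEigenvalue L n)⁻¹ ≤ T) (h2 : rapidEigenvalue L n * T ≤ √(L n)) :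
    Real.exp (-1) / 4 ≤ cesaro (heatKernel τ q (diagonal p (rapidEigenvalue L))) T := by
  set a := rapidEigenvalue L n with ha
  have ha0 : 0 < a := h.rapid.eigenvalue_pos n
  have hL0 := h.rapid.pos n
  have hainv : 0 < a⁻¹ := inv_pos.mpr ha0
  have ha1 : 1 < a⁻¹ := by
    by_contra! hle
    have := Real.log_nonpos hainv.le hle
    linarith [h.rapid.log_inv_eigenvalue_ge n]
  have hT1 : 1 < T := by linarith
  have hTlog : Real.log T ≤ L n := by
    have h3 := h2.trans (h.rapid.sqrt_le n)
    rw [← IsRapid.eigenvalue_mul_exp (L := L) n] at h3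
    have h4 : T ≤ Real.exp (L n) := le_of_mul_le_mul_left h3 ha0
    simpa using Real.log_le_log (by linarith) h4
  set k := fun s => heatKernel τ q (diagonal p (rapidEigenvalue L)) s / s with hk
  have hknn : ∀ s, 0 ≤ k s := heatKernel_div_nonneg τ q _
  have hkint : ∀ x y : ℝ, 0 < x → 0 < y → IntervalIntegrable k volume x y :=
    fun x y hx hy => h.intervalIntegrable_heatKernel_div hq hx hy
  have hkge : ∀ s ∈ Set.Icc a⁻¹ (2 * a⁻¹), Real.exp (-1) * (L n * a) / 4 ≤ k s := by
    intro s hs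
    have hs0 : 0 < s := hainv.trans_le hs.1
    have hsa : 1 ≤ s * a := by
      have := mul_le_mul_of_nonneg_right hs.1 ha0.le
      rwa [inv_mul_cancel₀ ha0.ne'] at this
    have hs2 : a ^ 2 / 4 ≤ (s ^ 2)⁻¹ := by
      rw [le_inv_comm₀ (by positivity) (by positivity)]
      calc s ^ 2 ≤ (2 * a⁻¹) ^ 2 := by gcongr; exact hs.2
        _ = (a ^ 2 / 4)⁻¹ := by field_simp; norm_num
    have hg : Real.exp (-1) ≤ heatProfile q s a := by
      rw [heatProfile_of_pos q s ha0]
      exact Real.exp_le_exp.mpr (neg_le_neg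
        (Real.rpow_le_one_of_one_le_of_nonpos hsa (by linarith)))
    have hterm : heatProfile q s a * Real.exp (L n) ≤
        ∑' j, heatProfile q s (rapidEigenvalue L j) * Real.exp (L j) :=
      (h.summable_heatProfile hq hs0).le_tsum n fun j _ =>
        mul_nonneg (heatProfile_nonneg _ _ _) (Real.exp_pos _).le
    rw [hk]
    simp only
    rw [h.heatKernel_div_eq hq hs0]
    calc Real.exp (-1) * (L n * a) / 4
        = a ^ 2 / 4 * (Real.exp (-1) * Real.exp (L n)) := by
          rw [ha, ← eigenvalue_sq_mul_exp]; ring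
      _ ≤ (s ^ 2)⁻¹ * (heatProfile q s a * Real.exp (L n)) := by gcongr
      _ ≤ _ := by gcongr
  have hmid : Real.exp (-1) / 4 * L n ≤ ∫ s in a⁻¹..(2 * a⁻¹), k s := by
    have hle : a⁻¹ ≤ 2 * a⁻¹ := by linarith
    calc Real.exp (-1) / 4 * L n = ∫ _ in a⁻¹..(2 * a⁻¹), Real.exp (-1) * (L n * a) / 4 := by
          rw [intervalIntegral.integral_const, smul_eq_mul]
          field_simp
          ring
      _ ≤ _ := intervalIntegral.integral_mono_on hle (by simp)
          (hkint _ _ hainv (by linarith)) hkge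
  have hJ : Real.exp (-1) / 4 * L n ≤ ∫ s in (1 : ℝ)..T, k s := by
    refine hmid.trans (intervalIntegral.integral_mono_interval ha1.le (by linarith) h1
      (Eventually.of_forall hknn) (hkint _ _ one_pos (by linarith)))
  have hlogpos : 0 < Real.log T := Real.log_pos hT1
  rw [cesaro, one_div, le_inv_mul_iff₀ hlogpos]
  refine le_trans ?_ hJ
  rw [mul_comm]
  gcongr

end IsRapidSequence

end HeatKernel

end NoncommHeat

namespace NoncommHeat

/-! ### The windows in logarithmic coordinates. -/

section Windows

theorem IsRapid.tendsto_window_start {L : ℕ → ℝ} (hL : IsRapid L) :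
    Tendsto (fun n => Real.log (2 * (rapidEigenvalue L n)⁻¹)) atTop atTop := by
  refine tendsto_atTop_mono (fun n => ?_) (hL.tendsto.atTop_div_const two_pos)
  have hpos : 0 < (rapidEigenvalue L n)⁻¹ := inv_pos.mpr (hL.eigenvalue_pos n)
  exact (hL.log_inv_eigenvalue_ge n).trans (Real.log_le_log hpos (by linarith))

theorem IsRapid.tendsto_window_length {L : ℕ → ℝ} (hL : IsRapid L) :
    Tendsto (fun n => Real.log (√(L n) * (rapidEigenvalue L n)⁻¹) -
      Real.log (2 * (rapidEigenvalue L n)⁻¹)) atTop atTop := by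
  have h1 : Tendsto (fun n => Real.log (√(L n)) - Real.log 2) atTop atTop :=
    tendsto_atTop_add_const_right _ _
      (Real.tendsto_log_atTop.comp (Real.tendsto_sqrt_atTop.comp hL.tendsto))
  refine h1.congr fun n => ?_
  have hpos : 0 < (rapidEigenvalue L n)⁻¹ := inv_pos.mpr (hL.eigenvalue_pos n)
  rw [Real.log_mul (Real.sqrt_pos.mpr (hL.pos n)).ne' hpos.ne', Real.log_mul two_ne_zero hpos.ne']
  ring

theorem IsRapid.exp_mem_window {L : ℕ → ℝ} (hL : IsRapid L) {n : ℕ} {x : ℝ}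
    (hx : x ∈ Set.Icc (Real.log (2 * (rapidEigenvalue L n)⁻¹))
      (Real.log (√(L n) * (rapidEigenvalue L n)⁻¹))) :
    2 * (rapidEigenvalue L n)⁻¹ ≤ Real.exp x ∧ rapidEigenvalue L n * Real.exp x ≤ √(L n) := by
  have ha := hL.eigenvalue_pos n
  have hs : 0 < √(L n) := Real.sqrt_pos.mpr (hL.pos n)
  refine ⟨(Real.log_le_iff_le_exp (by positivity)).mp hx.1, ?_⟩
  have h := (Real.le_log_iff_exp_le (by positivity)).mp hx.2
  rwa [← div_eq_mul_inv, le_div_iff₀ ha, mul_comm] at h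

end Windows

end NoncommHeat

/-! ### The counterexample. -/

open NoncommHeat MeasureTheory
open scoped ENNReal
theorem mainTheorem6 {H : Type*} [NormedAddCommGroup H] [InnerProductSpace ℂ H] [CompleteSpace H]
    (N : VonNeumannAlgebra H) (τ : FNSTrace N) (hτ : τ.toFun 1 = ∞)
    (hN : IsDiffuse N ∨ ∀ x : H →L[ℂ] H, x ∈ N) (q : ℝ) (hq : 0 < q) :
    ∃ (A : H →L[ℂ] H) (ω : LInfty →ₗ[ℝ] ℝ),
      A ∈ dixmierIdeal τ ∧ 0 ≤ A ∧
      IsGeneralisedLimit ω ∧ IsDilationInvariant ω ∧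
      -- the functions to which `ω` is applied are well defined elements of `L_∞(0, ∞)`
      MemLp (dixmierMean τ A) ∞ halfLine ∧
      (∀ t : ℝ, 0 < t → τ.toFun (heatOperator q A t) ≠ ∞) ∧
      LocallyIntegrableOn (heatKernel τ q A) (Set.Ioi 0) ∧
      MemLp (cesaro (heatKernel τ q A)) ∞ halfLine ∧
      Real.Gamma (1 + 1 / q) * dixmierTrace τ ω A < heatFunctional τ q ω A := by
  obtain ⟨p, L, h⟩ := τ.exists_isRapidSequence hτ
  have hL := h.rapid
  obtain ⟨ω, hlim, hdil, hlower⟩ := exists_dilationInvariant_generalisedLimit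
    hL.tendsto_window_start hL.tendsto_window_length
  set A := diagonal p (rapidEigenvalue L)
  obtain ⟨C, hC⟩ := h.exists_dixmierMean_le
  have hX : MemLp (dixmierMean τ A) ∞ halfLine := memLp_dixmierMean τ A hC
  have hY : MemLp (cesaro (heatKernel τ q A)) ∞ halfLine := h.memLp_cesaro_heatKernel hq
  refine ⟨A, ω, ⟨h.diagonal_mem h.summable_abs_eigenvalue, C, ?_⟩,
    h.diagonal_nonneg fun n => (hL.eigenvalue_pos n).le, hlim, hdil, hX,
    fun t ht => by rw [h.trace_heatOperator hq ht]; exact ENNReal.ofReal_ne_top,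
    h.locallyIntegrableOn_heatKernel hq, hY, ?_⟩
  · rintro _ ⟨t, ht, rfl⟩
    exact hC t ht
  have hupper : ω (hX.toLp (dixmierMean τ A)) ≤ 0 := by
    have hbound : Tendsto (fun n => 6 * (√(L n))⁻¹ +
        2 * (∑' k, L k ^ 2 * Real.exp (-(L k / 2))) * (L n)⁻¹) atTop (𝓝 0) := by
      have h1 := (Real.tendsto_sqrt_atTop.comp hL.tendsto).inv_tendsto_atTop.const_mul 6
      have h2 := hL.tendsto.inv_tendsto_atTop.const_mul
        (2 * (∑' k, L k ^ 2 * Real.exp (-(L k / 2))))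
      simpa using h1.add h2
    refine le_of_forall_pos_le_add fun ε hε => ?_
    -- The functional is only known to respect lower bounds on windows, so the upper bound comes
    -- from the negated function.
    have h1 : -ε ≤ ω (hX.neg.toLp (-dixmierMean τ A)) := by
      refine hlower _ hX.neg _ ?_
      filter_upwards [hbound.eventually (gt_mem_nhds hε)] with n hn x hx
      obtain ⟨hx1, hx2⟩ := hL.exp_mem_window hx
      have hinv : 0 < (rapidEigenvalue L n)⁻¹ := inv_pos.mpr (hL.eigenvalue_pos n)
      have h3 := h.dixmierMean_le_of_window n (by linarith) hx2
      exact neg_le_neg (h3.trans hn.le)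
    have h2 : hX.neg.toLp (-dixmierMean τ A) = -hX.toLp (dixmierMean τ A) := MemLp.toLp_neg hX
    rw [h2, map_neg] at h1
    linarith
  have hbelow : Real.exp (-1) / 4 ≤ ω (hY.toLp (cesaro (heatKernel τ q A))) := by
    refine hlower _ hY _ (Eventually.of_forall fun n x hx => ?_)
    obtain ⟨hx1, hx2⟩ := hL.exp_mem_window hx
    exact h.le_cesaro_heatKernel_of_window hq n hx1 hx2
  rw [dixmierTrace, heatFunctional, evalAt, evalAt, dif_pos hX, dif_pos hY]
  have hΓ : 0 < Real.Gamma (1 + 1 / q) := Real.Gamma_pos_of_pos (by positivity)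
  calc _ ≤ 0 := mul_nonpos_of_nonneg_of_nonpos hΓ.le hupper
    _ < Real.exp (-1) / 4 := by positivity
    _ ≤ _ := hbelow
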